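/- Let $k$ be a field, $V$ a finite-dimensional $k$-vector space, $N\ge 2$ an integer, $R\subseteq V^{\otimes N}$ a subspace, and let $A=\mathrm{Tens}(V)/I(R)$ be the associated $N$-homogeneous algebra, where $I(R)$ is the two-sided ideal of the tensor algebra generated by $R$; it is graded by $A_n=$ the image of $V^{\otimes n}$. Define $n(2q)=qN$ and $n(2q+1)=qN+1$ for integers $q\ge 0$. Assume that $A$ is (generalized) Koszul, i.e. for each $i\ge 3$ the graded vector space $\mathrm{Tor}_i^A(k,k)$ (computed from graded projective resolutions of the trivial module $k$) is concentrated in degree $n(i)$. Then the Hochschild dimension of $A$, i.e. the projective dimension $\mathrm{pd}_{A^e}(A)$ of $A$ as a module over $A^e=A\otimes_k A^{\circ}$, coincides with the global dimension of $A$: in $\mathbf{N}\cup\{\infty\}$, $$\mathrm{pd}_{A^e}(A)=\mathrm{l.gl.dim}(A)=\mathrm{r.gl.dim}(A).$$ -/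

import Mathlib

open CategoryTheory
open scoped TensorProduct MulOpposite

universe u v

noncomputable section

/-! ### Global dimension and Hochschild dimension -/

/-- The left global dimension of a ring: the supremum of the projective dimensions of all left
modules (in the universe of the ring, which is enough by Auslander's theorem, as all cyclic modules
are there). Values in `ℕ ∪ {∞}`, together with `⊥` for the zero ring. -/
def leftGlobalDimension (A : Type u) [Ring A] : WithBot ℕ∞ :=
  ⨆ M : ModuleCat.{u} A, projectiveDimension M

/-- The right global dimension of a ring; right modules are left modules over the opposite ring. -/
def rightGlobalDimension (A : Type u) [Ring A] : WithBot ℕ∞ :=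
  leftGlobalDimension Aᵐᵒᵖ

/-- The Hochschild dimension of a `k`-algebra `A`: the projective dimension of `A` as a left module
over `Aᵉ = A ⊗[k] Aᵐᵒᵖ`, with the action `(a ⊗ b) • m = a * m * b`. -/
def hochschildDimension (k : Type v) (A : Type u) [CommRing k] [Ring A] [Algebra k A] :
    WithBot ℕ∞ :=
  letI : Module (A ⊗[k] Aᵐᵒᵖ) A := TensorProduct.Algebra.module
  projectiveDimension (ModuleCat.of (A ⊗[k] Aᵐᵒᵖ) A)

/-! ### Homogeneous algebras -/

section Homogeneous

variable {k : Type u} [Field k] {V : Type v} [AddCommGroup V] [Module k V] {N : ℕ}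

/-- The `N`-homogeneous algebra `Tens(V) / I(R)` on `V` with space of relations `R ⊆ V^{⊗N}`: the
quotient of the tensor algebra by the two-sided ideal generated by `R`. -/
abbrev HomogeneousAlgebra (R : Submodule k (⨂[k]^N V)) : Type (max u v) :=
  RingQuot (fun x y : TensorAlgebra k V => (∃ r ∈ R, x = TensorPower.toTensorAlgebra r) ∧ y = 0)

namespace HomogeneousAlgebra

/-- The canonical projection `Tens(V) → A`. -/
def proj (R : Submodule k (⨂[k]^N V)) : TensorAlgebra k V →ₐ[k] HomogeneousAlgebra R :=
  RingQuot.mkAlgHom k _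

/-- The homogeneous component `A_n` of `A`: the image of `V^{⊗n}`. -/
def component (R : Submodule k (⨂[k]^N V)) (n : ℕ) : Submodule k (HomogeneousAlgebra R) :=
  LinearMap.range ((proj R).toLinearMap ∘ₗ (TensorPower.toTensorAlgebra (n := n)))

/-- The augmentation ideal `A_+ = ⨁_{n ≥ 1} A_n`. -/
def augmentationIdeal (R : Submodule k (⨂[k]^N V)) : Ideal (HomogeneousAlgebra R) :=
  Ideal.span {a | ∃ n : ℕ, 1 ≤ n ∧ a ∈ component R n}

/-- The trivial left `A`-module `k = A / A_+`. -/
abbrev trivialModule (R : Submodule k (⨂[k]^N V)) : ModuleCat.{max u v} (HomogeneousAlgebra R) :=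
  ModuleCat.of (HomogeneousAlgebra R) (HomogeneousAlgebra R ⧸ augmentationIdeal R)

/-- A `ℤ`-grading of a left `A`-module, compatible with the grading of `A`. (The components are
`k`-subspaces since `A_0` consists of the scalars.) -/
structure IsModuleGrading (R : Submodule k (⨂[k]^N V)) {M : Type*} [AddCommGroup M]
    [Module (HomogeneousAlgebra R) M] (g : ℤ → AddSubgroup M) : Prop where
  isInternal : DirectSum.IsInternal g
  smul_mem : ∀ (m : ℕ) (n : ℤ) (a : HomogeneousAlgebra R) (x : M),
    a ∈ component R m → x ∈ g n → a • x ∈ g (m + n)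

/-- A projective resolution `⋯ → P₁ → P₀ → k` of the trivial module in the category of graded left
`A`-modules with morphisms of degree `0`, the module `k` being concentrated in degree `0`. (A graded
module is projective in this category if and only if it is a projective module.) -/
structure GradedProjectiveResolution (R : Submodule k (⨂[k]^N V)) extends
    ProjectiveResolution (trivialModule R) where
  /-- the component of degree `n` of the `i`-th module -/
  grading : ∀ i : ℕ, ℤ → AddSubgroup (complex.X i)
  isModuleGrading : ∀ i, IsModuleGrading R (grading i)
  d_mem : ∀ (i j : ℕ) (n : ℤ) (x : complex.X i),
    x ∈ grading i n → complex.d i j x ∈ grading j n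
  π_eq_zero : ∀ (n : ℤ) (x : complex.X 0), n ≠ 0 → x ∈ grading 0 n → π.f 0 x = 0

namespace GradedProjectiveResolution

variable {R : Submodule k (⨂[k]^N V)} (P : GradedProjectiveResolution R)

/-- The kernel `A_+ P_i` of the projection from `P_i` onto `k ⊗_A P_i = P_i / A_+ P_i`. -/
def radical (i : ℕ) : AddSubgroup (P.complex.X i) :=
  (augmentationIdeal R • (⊤ : Submodule (HomogeneousAlgebra R) (P.complex.X i))).toAddSubgroup

/-- The elements of degree `n` of `P_i` that represent cycles of the complex `k ⊗_A P`. -/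
def torCycles (i : ℕ) (n : ℤ) : AddSubgroup (P.complex.X i) :=
  P.grading i n ⊓ (P.radical (i - 1)).comap (P.complex.d i (i - 1)).hom.toAddMonoidHom

/-- The elements of `P_i` that represent boundaries of the complex `k ⊗_A P`. -/
def torBoundaries (i : ℕ) : AddSubgroup (P.complex.X i) :=
  (P.complex.d (i + 1) i).hom.toAddMonoidHom.range ⊔ P.radical i

/-- The component of degree `n` of the graded vector space `Tor_i^A(k, k) = H_i(k ⊗_A P)`. -/
abbrev Tor (i : ℕ) (n : ℤ) : Type (max u v) :=
  P.torCycles i n ⧸ (P.torBoundaries i).addSubgroupOf (P.torCycles i n)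

end GradedProjectiveResolution

end HomogeneousAlgebra

/-- The jump map `n(2q) = qN`, `n(2q + 1) = qN + 1`. -/
def jumpMap (N i : ℕ) : ℕ :=
  if Even i then (i / 2) * N else (i / 2) * N + 1

/-- The `N`-homogeneous algebra `A` with relations `R` is (generalized) Koszul if, for each `i ≥ 3`,
the graded vector space `Tor_i^A(k, k)` is concentrated in degree `n(i)`. The graded spaces
`Tor_i^A(k, k)` are computed from a graded projective resolution of `k`; they do not depend on it. -/
def IsKoszul (R : Submodule k (⨂[k]^N V)) : Prop :=
  ∃ P : HomogeneousAlgebra.GradedProjectiveResolution R,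
    ∀ i : ℕ, 3 ≤ i → ∀ n : ℤ, n ≠ jumpMap N i → Subsingleton (P.Tor i n)

end Homogeneous

end

/-! ### Projective dimension and surjections from projective modules -/

/-! The argument concerns any `ℕ`-graded algebra `A` whose part of degree `0` consists of scalars.
It rests on the chain pd_{A^e}(A) ≤ pd_A(A / A_+) ≤ l.gl.dim(A) ≤ pd_{A^e}(A); the right-hand
version follows by exchanging `A` and its opposite.

Both outer inequalities are proved by induction on a bound for the projective dimension, using
canonical syzygies: the kernel ΩX of `A ⊗ X → X` for a bimodule `X`, and the kernel ΩY of `A ⊗ Y →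
Y` for a left module `Y`. The map `x ↦ 1 ⊗ x` splits `A ⊗ X → X` right linearly. Hence, if `X` is
right projective, so is ΩX, while `A ⊗ X` is a projective bimodule; and Ω commutes with tensoring
over `A` with a left module `M`.

For the last inequality, start from `X = A` and an arbitrary `M`: a bound for `X` passes to `X ⊗_A
M` (`IsTensorOver.hasProjectiveDimensionLT`). For the first one, a bound for `Y = X / X A_+` passes
back to `X` when `X` is graded and right projective (`IsRightReduction.hasProjectiveDimensionLT`).
The crucial case is that of `Y` projective (`IsRightReduction.projective`): a homogeneous left
linear section `σ` of `X → Y` yields a map `b ⊗ y ↦ σ(y) b`, which is surjective by graded Nakayama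
and injective by right projectivity and Nakayama again. So `X` is isomorphic to `Y ⊗ A`, a
projective bimodule. -/

/-- Dimension shifting. The indices start at `2` and `1`, since a projective `X` need not have zero
kernel. -/
theorem hasProjectiveDimensionLT_ker_iff {B : Type u} [Ring B] {Q X : Type u} [AddCommGroup Q]
    [Module B Q] [AddCommGroup X] [Module B X] [Module.Projective B Q] (f : Q →ₗ[B] X)
    (hf : Function.Surjective f) (n : ℕ) :
    HasProjectiveDimensionLT (ModuleCat.of B X) (n + 2) ↔
      HasProjectiveDimensionLT (ModuleCat.of B (LinearMap.ker f)) (n + 1) := by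
  have hS : (ShortComplex.mk (ModuleCat.ofHom (LinearMap.ker f).subtype) (ModuleCat.ofHom f)
      (by ext x; exact x.2)).ShortExact :=
    { exact := by
        rw [ShortComplex.ShortExact.moduleCat_exact_iff_function_exact]
        exact f.exact_subtype_ker_map
      mono_f := (ModuleCat.mono_iff_injective _).2 (Submodule.injective_subtype _)
      epi_g := (ModuleCat.epi_iff_surjective _).2 hf }
  exact hS.hasProjectiveDimensionLT_X₃_iff n
    ((IsProjective.iff_projective (R := B) Q).1 inferInstance)

theorem hasProjectiveDimensionLT_one_iff {B X : Type u} [Ring B] [AddCommGroup X] [Module B X] :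
    HasProjectiveDimensionLT (ModuleCat.of B X) 1 ↔ Module.Projective B X := by
  rw [← projective_iff_hasProjectiveDimensionLT_one, ← IsProjective.iff_projective]

theorem hasProjectiveDimensionLT_zero_iff {B X : Type u} [Ring B] [AddCommGroup X] [Module B X] :
    HasProjectiveDimensionLT (ModuleCat.of B X) 0 ↔ Subsingleton X := by
  rw [hasProjectiveDimensionLT_zero_iff_isZero, ModuleCat.isZero_iff_subsingleton]

/-- Finite thresholds suffice, so inductions on `n` also settle infinite dimension and the value `⊥`
of zero modules. -/
theorem projectiveDimension_le_of_forall {B C X Y : Type u} [Ring B] [AddCommGroup X] [Module B X]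
    [Ring C] [AddCommGroup Y] [Module C Y]
    (h : ∀ n, HasProjectiveDimensionLT (ModuleCat.of B X) n →
      HasProjectiveDimensionLT (ModuleCat.of C Y) n) :
    projectiveDimension (ModuleCat.of C Y) ≤ projectiveDimension (ModuleCat.of B X) := by
  simp only [← projectiveDimension_lt_iff] at h
  generalize projectiveDimension (ModuleCat.of B X) = b at *
  induction b with
  | bot =>
    exact ((WithBot.lt_zero_iff_eq_bot _).1 (h 0 (WithBot.bot_lt_coe (0 : ℕ∞)))).le
  | coe b =>
    induction b with
    | top => exact le_top
    | coe b =>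
      have := h (b + 1) (by exact_mod_cast Nat.lt_succ_self b)
      exact ENat.WithBot.lt_add_one_iff.1 (by exact_mod_cast this)

/-! ### Modules over an algebra and their canonical syzygies -/

section LeftModule

variable (k : Type v) [Field k] (A : Type u) [Ring A] [Algebra k A]
variable (Y : Type u) [AddCommGroup Y] [Module k Y] [Module A Y] [IsScalarTower k A Y]

/-- The action map `A ⊗ Y → Y`. -/
def actionMap : A ⊗[k] Y →ₗ[A] Y :=
  { TensorProduct.lift (Algebra.lsmul k k Y : A →ₐ[k] Module.End k Y).toLinearMap with
    map_smul' := fun a z => by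
      induction z with
      | zero => simp
      | add z w hz hw => simp_all
      | tmul b y => simp [TensorProduct.smul_tmul'] }

@[simp] theorem actionMap_tmul (a : A) (y : Y) : actionMap k A Y (a ⊗ₜ y) = a • y := rfl

theorem actionMap_surjective : Function.Surjective (actionMap k A Y) :=
  fun y => ⟨1 ⊗ₜ y, by simp⟩

/-- The kernel of the action map `A ⊗ Y → Y`. -/
abbrev Syzygy : Submodule A (A ⊗[k] Y) := LinearMap.ker (actionMap k A Y)

/-- The retraction `a ⊗ y ↦ a ⊗ y - 1 ⊗ a y` of `A ⊗ Y` onto the kernel of the action map. -/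
def syzygyProj : A ⊗[k] Y →ₗ[k] Syzygy k A Y :=
  (LinearMap.id - TensorProduct.mk k A Y 1 ∘ₗ (actionMap k A Y).restrictScalars k).codRestrict
    ((Syzygy k A Y).restrictScalars k) (fun z => by simp)

theorem coe_syzygyProj (z : A ⊗[k] Y) :
    (syzygyProj k A Y z : A ⊗[k] Y) = z - 1 ⊗ₜ actionMap k A Y z := rfl

theorem syzygyProj_coe (z : Syzygy k A Y) : syzygyProj k A Y z = z :=
  Subtype.ext (by simp [coe_syzygyProj])

/-- Over a field `A ⊗ Y` is free over `A`, so projectivity of `Y` amounts to a splitting of the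
action map, a form that is easy to transport. -/
theorem exists_section_actionMap [Module.Projective A Y] :
    ∃ s : Y →ₗ[A] A ⊗[k] Y, ∀ y, actionMap k A Y (s y) = y := by
  obtain ⟨s, hs⟩ := Module.projective_lifting_property (actionMap k A Y) LinearMap.id
    (actionMap_surjective k A Y)
  exact ⟨s, fun y => LinearMap.congr_fun hs y⟩

theorem projective_of_section_actionMap (s : Y →ₗ[A] A ⊗[k] Y)
    (hs : ∀ y, actionMap k A Y (s y) = y) : Module.Projective A Y :=
  Module.Projective.of_split s (actionMap k A Y) (LinearMap.ext hs)

end LeftModule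

/-! ### Bimodules -/

section Bimodule

/-- The enveloping algebra of `A`, whose left modules are the `A`-bimodules. -/
abbrev Env (k : Type v) [CommRing k] (A : Type u) [Ring A] [Algebra k A] : Type u := A ⊗[k] Aᵐᵒᵖ

variable (k : Type v) [Field k] (A : Type u) [Ring A] [Algebra k A]
variable (X : Type u) [AddCommGroup X] [Module k X] [Module (Env k A) X]
  [IsScalarTower k (Env k A) X]

/-- The action of `A` on a bimodule from the left. -/
def leftAct : A →ₐ[k] Module.End k X :=
  (Algebra.lsmul k k X).comp (Algebra.TensorProduct.includeLeft : A →ₐ[k] Env k A)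

/-- The action of `A` on a bimodule from the right. -/
def rightAct : Aᵐᵒᵖ →ₐ[k] Module.End k X :=
  (Algebra.lsmul k k X).comp (Algebra.TensorProduct.includeRight : Aᵐᵒᵖ →ₐ[k] Env k A)

variable {X}

theorem tmul_smul (a : A) (b : Aᵐᵒᵖ) (x : X) :
    (a ⊗ₜ[k] b : Env k A) • x = leftAct k A X a (rightAct k A X b x) := by
  change _ = (a ⊗ₜ[k] 1 : Env k A) • (1 ⊗ₜ[k] b : Env k A) • x
  rw [smul_smul, Algebra.TensorProduct.tmul_mul_tmul, mul_one, one_mul]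

theorem rightAct_leftAct (a : A) (b : Aᵐᵒᵖ) (x : X) :
    rightAct k A X b (leftAct k A X a x) = leftAct k A X a (rightAct k A X b x) := by
  rw [← tmul_smul]
  change (1 ⊗ₜ[k] b : Env k A) • (a ⊗ₜ[k] 1 : Env k A) • x = _
  rw [smul_smul, Algebra.TensorProduct.tmul_mul_tmul, mul_one, one_mul]

variable {k A} in
theorem LinearMap.map_leftAct {X' : Type u} [AddCommGroup X'] [Module k X'] [Module (Env k A) X']
    [IsScalarTower k (Env k A) X'] (f : X →ₗ[Env k A] X') (a : A) (x : X) :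
    f (leftAct k A X a x) = leftAct k A X' a (f x) := f.map_smul _ x

variable {k A} in
theorem LinearMap.map_rightAct {X' : Type u} [AddCommGroup X'] [Module k X'] [Module (Env k A) X']
    [IsScalarTower k (Env k A) X'] (f : X →ₗ[Env k A] X') (b : Aᵐᵒᵖ) (x : X) :
    f (rightAct k A X b x) = rightAct k A X' b (f x) := f.map_smul _ x

variable {k A} in
/-- A `k`-linear map commuting with both actions of `A` is a bimodule morphism. -/
def bimoduleHom {X' : Type u} [AddCommGroup X'] [Module k X'] [Module (Env k A) X']
    [IsScalarTower k (Env k A) X'] (f : X →ₗ[k] X')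
    (hl : ∀ a x, f (leftAct k A X a x) = leftAct k A X' a (f x))
    (hr : ∀ b x, f (rightAct k A X b x) = rightAct k A X' b (f x)) : X →ₗ[Env k A] X' :=
  { f with
    map_smul' := fun c x => by
      induction c using TensorProduct.induction_on with
      | zero =>
        exact (congrArg f (zero_smul (Env k A) x)).trans
          ((map_zero f).trans (zero_smul (Env k A) (f x)).symm)
      | add c d hc hd => simp_all [add_smul]
      | tmul a b => simp [tmul_smul, hl, hr] }

variable (X)

/-- The bimodule `A ⊗ X`, where `A` acts from the left on the first factor and from the right on
the second one. -/
abbrev LeftInduced : Type u := A ⊗[k] X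

/-- The action of the enveloping algebra on `A ⊗ X`. -/
def LeftInduced.act : Env k A →ₐ[k] Module.End k (LeftInduced k A X) :=
  (Module.endTensorEndAlgHom (R := k) (S := k) (A := k) (M := A) (N := X)).comp
    (Algebra.TensorProduct.map (Algebra.lsmul k k A) (rightAct k A X))

instance : Module (Env k A) (LeftInduced k A X) :=
  Module.compHom _ (LeftInduced.act k A X).toRingHom

theorem LeftInduced.smul_eq (c : Env k A) (z : LeftInduced k A X) :
    c • z = LeftInduced.act k A X c z := rfl

instance : IsScalarTower k (Env k A) (LeftInduced k A X) where
  smul_assoc r c z := by simp [LeftInduced.smul_eq]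

theorem leftAct_leftInduced (a : A) :
    leftAct k A (LeftInduced k A X) a =
      TensorProduct.map (Algebra.lsmul k k A a) (LinearMap.id : X →ₗ[k] X) := by
  have : rightAct k A X 1 = LinearMap.id := map_one _
  refine LinearMap.ext fun z => ?_
  change (TensorProduct.map (Algebra.lsmul k k A a) (rightAct k A X 1)) z = _
  rw [this]

theorem rightAct_leftInduced (b : Aᵐᵒᵖ) :
    rightAct k A (LeftInduced k A X) b =
      TensorProduct.map (LinearMap.id : A →ₗ[k] A) (rightAct k A X b) := by
  have : Algebra.lsmul k k A (1 : A) = LinearMap.id := map_one _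
  refine LinearMap.ext fun z => ?_
  change (TensorProduct.map (Algebra.lsmul k k A (1 : A)) (rightAct k A X b)) z = _
  rw [this]

/-- The left action `A ⊗ X → X`, as a bimodule morphism. -/
def biActionMap : LeftInduced k A X →ₗ[Env k A] X :=
  bimoduleHom (TensorProduct.lift (leftAct k A X).toLinearMap)
    (fun a z => by
      rw [leftAct_leftInduced]
      induction z using TensorProduct.induction_on with
      | zero => simp
      | add z w hz hw => simp_all
      | tmul b y => simp)
    (fun b z => by
      rw [rightAct_leftInduced]
      induction z using TensorProduct.induction_on with
      | zero => simp
      | add z w hz hw => simp_all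
      | tmul b y => simp [rightAct_leftAct])

theorem biActionMap_tmul (a : A) (x : X) :
    biActionMap k A X (a ⊗ₜ[k] x : A ⊗[k] X) = leftAct k A X a x := rfl

theorem biActionMap_surjective : Function.Surjective (biActionMap k A X) :=
  fun x => ⟨(1 ⊗ₜ[k] x : A ⊗[k] X), by simp [biActionMap_tmul]⟩

/-- The kernel of `A ⊗ X → X`. -/
abbrev BiSyzygy : Submodule (Env k A) (LeftInduced k A X) := LinearMap.ker (biActionMap k A X)

/-- The retraction `a ⊗ x ↦ a ⊗ x - 1 ⊗ a x` of `A ⊗ X` onto the kernel of `A ⊗ X → X`. -/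
def biSyzygyProj : LeftInduced k A X →ₗ[k] BiSyzygy k A X :=
  (LinearMap.id - (TensorProduct.mk k A X 1 : X →ₗ[k] LeftInduced k A X) ∘ₗ
    (biActionMap k A X).restrictScalars k).codRestrict
    ((BiSyzygy k A X).restrictScalars k) (fun z => by
      have := biActionMap_tmul k A X 1 (biActionMap k A X z)
      rw [map_one] at this
      simp only [Submodule.restrictScalars_mem, LinearMap.mem_ker, LinearMap.sub_apply, map_sub]
      exact sub_eq_zero.2 this.symm)

theorem coe_biSyzygyProj (z : LeftInduced k A X) :
    (biSyzygyProj k A X z : LeftInduced k A X) =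
      z - (1 ⊗ₜ[k] biActionMap k A X z : A ⊗[k] X) := rfl

theorem biSyzygyProj_coe (z : BiSyzygy k A X) : biSyzygyProj k A X z = z :=
  Subtype.ext (by
    rw [coe_biSyzygyProj, LinearMap.mem_ker.1 z.2, TensorProduct.tmul_zero]; exact sub_zero _)

theorem coe_rightAct (S : Submodule (Env k A) X) (b : Aᵐᵒᵖ) (z : S) :
    (rightAct k A S b z : X) = rightAct k A X b z := rfl

theorem coe_leftAct (S : Submodule (Env k A) X) (a : A) (z : S) :
    (leftAct k A S a z : X) = leftAct k A X a z := rfl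

/-- The right action touches only the factor `X`, so `x ↦ 1 ⊗ x` is right linear. The syzygy
sequence thus splits over the right action, though in general not as bimodules. -/
theorem biSyzygyProj_rightAct (b : Aᵐᵒᵖ) (z : LeftInduced k A X) :
    biSyzygyProj k A X (rightAct k A _ b z) = rightAct k A _ b (biSyzygyProj k A X z) := by
  apply Subtype.ext
  rw [coe_biSyzygyProj, coe_rightAct, coe_biSyzygyProj, map_sub, LinearMap.map_rightAct]
  congr 1
  rw [rightAct_leftInduced]
  rfl

/-- A bimodule is projective as a right module if the right action `X ⊗ A → X` has a section. -/
def IsRightProjective : Prop :=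
  ∃ s : X →ₗ[k] Aᵐᵒᵖ ⊗[k] X, (∀ b x, s (rightAct k A X b x) = b • s x) ∧
    ∀ x, TensorProduct.lift (rightAct k A X).toLinearMap (s x) = x

variable {k A X}

theorem IsRightProjective.of_retract {X' : Type u} [AddCommGroup X'] [Module k X']
    [Module (Env k A) X'] [IsScalarTower k (Env k A) X'] (h : IsRightProjective k A X)
    (i : X' →ₗ[k] X) (r : X →ₗ[k] X')
    (hi : ∀ b x, i (rightAct k A X' b x) = rightAct k A X b (i x))
    (hr : ∀ b x, r (rightAct k A X b x) = rightAct k A X' b (r x))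
    (hri : ∀ x, r (i x) = x) : IsRightProjective k A X' := by
  obtain ⟨s, hs, hsec⟩ := h
  refine ⟨r.lTensor Aᵐᵒᵖ ∘ₗ s ∘ₗ i, fun b x => ?_, fun x => ?_⟩
  · simp only [LinearMap.comp_apply, hi, hs]
    generalize s (i x) = z
    induction z with
    | zero => simp
    | add z w hz hw => simp_all
    | tmul c x => simp [TensorProduct.smul_tmul']
  · simp only [LinearMap.comp_apply]
    conv_rhs => rw [← hri x, ← hsec (i x)]
    generalize s (i x) = z
    induction z with
    | zero => simp
    | add z w hz hw => simp_all
    | tmul c x => simp [hr]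

/-- As a right module, `A ⊗ X` is a direct sum of copies of `X`, indexed by a basis of `A`. -/
theorem IsRightProjective.leftInduced (h : IsRightProjective k A X) :
    IsRightProjective k A (LeftInduced k A X) := by
  obtain ⟨s, hs, hsec⟩ := h
  refine ⟨(TensorProduct.leftComm k A Aᵐᵒᵖ X).toLinearMap ∘ₗ s.lTensor A, fun b z => ?_,
    fun z => ?_⟩
  · rw [rightAct_leftInduced]
    induction z using TensorProduct.induction_on with
    | zero => simp
    | add z w hz hw => simp_all
    | tmul a x =>
      simp only [TensorProduct.map_tmul, LinearMap.comp_apply, LinearMap.lTensor_tmul, hs]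
      generalize s x = z
      induction z with
      | zero => simp
      | add z w hz hw => simp_all [TensorProduct.tmul_add]
      | tmul c x => simp [TensorProduct.smul_tmul']
  · induction z using TensorProduct.induction_on with
    | zero => simp
    | add z w hz hw => rw [map_add, map_add, hz, hw]
    | tmul a x =>
      conv_rhs => rw [← hsec x]
      simp only [LinearMap.comp_apply, LinearMap.lTensor_tmul]
      generalize s x = z
      induction z with
      | zero => simp
      | add z w hz hw => simp_all [TensorProduct.tmul_add]
      | tmul c x => simp [rightAct_leftInduced]

theorem IsRightProjective.biSyzygy (h : IsRightProjective k A X) :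
    IsRightProjective k A (BiSyzygy k A X) :=
  h.leftInduced.of_retract ((BiSyzygy k A X).subtype.restrictScalars k) (biSyzygyProj k A X)
    (fun b z => coe_rightAct k A _ _ b z) (biSyzygyProj_rightAct k A X) (biSyzygyProj_coe k A X)

/-- The bimodule `A ⊗ X` is projective if `X` is projective as a right module. -/
theorem IsRightProjective.projective_leftInduced (h : IsRightProjective k A X) :
    Module.Projective (Env k A) (LeftInduced k A X) := by
  obtain ⟨s, hs, hsec⟩ := h
  -- The right linear section `s` embeds `A ⊗ X` into `A ⊗ Aᵐᵒᵖ ⊗ X`, which is free over the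
  -- enveloping algebra; the action of that algebra gives the retraction `r`.
  let j : LeftInduced k A X →ₗ[k] Env k A ⊗[k] X :=
    (TensorProduct.assoc k A Aᵐᵒᵖ X).symm.toLinearMap ∘ₗ s.lTensor A
  let i : LeftInduced k A X →ₗ[Env k A] Env k A ⊗[k] X :=
    { j with
      map_smul' := fun c z => by
        induction z using TensorProduct.induction_on with
        | zero => simp
        | add z w hz hw => simp_all
        | tmul a x =>
          induction c using TensorProduct.induction_on with
          | zero =>
            exact (congrArg j (zero_smul (Env k A) _)).trans
              ((map_zero j).trans (zero_smul (Env k A) (j (a ⊗ₜ[k] x))).symm)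
          | add c d hc hd => simp_all [add_smul]
          | tmul a' b =>
            have : (a' ⊗ₜ[k] b : Env k A) • (a ⊗ₜ[k] x : LeftInduced k A X) =
              ((a' * a) ⊗ₜ[k] rightAct k A X b x : A ⊗[k] X) := rfl
            rw [this]
            simp only [j, LinearMap.comp_apply, LinearMap.lTensor_tmul, hs, AddHom.toFun_eq_coe,
              LinearMap.coe_toAddHom]
            generalize s x = z
            induction z with
            | zero => simp
            | add z w hz hw => simp_all [TensorProduct.tmul_add]
            | tmul c x => simp [TensorProduct.smul_tmul'] }
  let r : Env k A ⊗[k] X →ₗ[Env k A] LeftInduced k A X :=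
    actionMap k (Env k A) (LeftInduced k A X) ∘ₗ
      TensorProduct.AlgebraTensorModule.map LinearMap.id
        (TensorProduct.mk k A X 1 : X →ₗ[k] LeftInduced k A X)
  refine Module.Projective.of_split i r (LinearMap.ext fun z => ?_)
  induction z using TensorProduct.induction_on with
  | zero => simp
  | add z w hz hw => rw [map_add, map_add, hz, hw]
  | tmul a x =>
    have h2 : i (a ⊗ₜ[k] x : A ⊗[k] X) = (TensorProduct.assoc k A Aᵐᵒᵖ X).symm (a ⊗ₜ s x) := rfl
    conv_rhs => rw [← hsec x]
    rw [LinearMap.comp_apply, h2]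
    generalize s x = z
    induction z with
    | zero => simp
    | add z w hz hw => simp_all [TensorProduct.tmul_add]
    | tmul c x =>
      simp [r]
      have : (a ⊗ₜ[k] c : Env k A) • (1 ⊗ₜ[k] x : LeftInduced k A X) =
              ((a * 1) ⊗ₜ[k] rightAct k A X c x : A ⊗[k] X) := rfl
      rw [this, mul_one]

end Bimodule

/-! ### Tensor products of bimodules with left modules over the algebra -/

section TensorOverAlgebra

variable {k : Type v} [Field k] {A : Type u} [Ring A] [Algebra k A]
variable {X : Type u} [AddCommGroup X] [Module k X] [Module (Env k A) X]
  [IsScalarTower k (Env k A) X]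
variable {M : Type u} [AddCommGroup M] [Module k M] [Module A M]
variable {Y : Type u} [AddCommGroup Y] [Module k Y] [Module A Y] [IsScalarTower k A Y]

variable (k A X M) in
/-- The kernel of the projection `X ⊗[k] M → X ⊗[A] M`. -/
def balancedRelations : Submodule k (X ⊗[k] M) :=
  Submodule.span k
    {t | ∃ (b : Aᵐᵒᵖ) (x : X) (m : M), t = rightAct k A X b x ⊗ₜ m - x ⊗ₜ (b.unop • m)}

theorem balancedRelations_le_comap {X' : Type u}
    [AddCommGroup X'] [Module k X'] [Module (Env k A) X'] [IsScalarTower k (Env k A) X']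
    (f : X →ₗ[k] X') (hf : ∀ b x, f (rightAct k A X b x) = rightAct k A X' b (f x))
    (M : Type u) [AddCommGroup M] [Module k M] [Module A M] :
    balancedRelations k A X M ≤ (balancedRelations k A X' M).comap (f.rTensor M) := by
  refine Submodule.span_le.2 ?_
  rintro _ ⟨b, x, m, rfl⟩
  rw [SetLike.mem_coe, Submodule.mem_comap, map_sub, LinearMap.rTensor_tmul,
    LinearMap.rTensor_tmul, hf]
  exact Submodule.subset_span ⟨b, f x, m, rfl⟩

/-- The map `τ` exhibits the left module `Y` as the tensor product `X ⊗[A] M` of the bimodule `X`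
and the left module `M`. -/
structure IsTensorOver (τ : X ⊗[k] M →ₗ[k] Y) : Prop where
  surjective : Function.Surjective τ
  leftAct_tmul : ∀ a x m, τ (leftAct k A X a x ⊗ₜ m) = a • τ (x ⊗ₜ m)
  rightAct_tmul : ∀ b x m, τ (rightAct k A X b x ⊗ₜ m) = τ (x ⊗ₜ (b.unop • m))
  ker_le : LinearMap.ker τ ≤ balancedRelations k A X M

variable (A) in
/-- The map induced on syzygies by a map `X ⊗ M → Y`. -/
def syzygyTensorMap (τ : X ⊗[k] M →ₗ[k] Y) : BiSyzygy k A X ⊗[k] M →ₗ[k] Syzygy k A Y :=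
  syzygyProj k A Y ∘ₗ τ.lTensor A ∘ₗ (TensorProduct.assoc k A X M).toLinearMap ∘ₗ
    ((BiSyzygy k A X).subtype.restrictScalars k).rTensor M

omit [Module A M] in
theorem syzygyTensorMap_tmul (τ : X ⊗[k] M →ₗ[k] Y) (z : BiSyzygy k A X) (m : M) :
    syzygyTensorMap A τ (z ⊗ₜ m) = syzygyProj k A Y
      (τ.lTensor A (TensorProduct.assoc k A X M ((z : A ⊗[k] X) ⊗ₜ m))) := rfl

omit [Module A M] [Module A Y] [IsScalarTower k A Y] in
theorem lTensor_assoc_leftAct (τ : X ⊗[k] M →ₗ[k] Y) (a : A) (z : A ⊗[k] X) (m : M) :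
    τ.lTensor A (TensorProduct.assoc k A X M (leftAct k A (LeftInduced k A X) a z ⊗ₜ m)) =
      a • τ.lTensor A (TensorProduct.assoc k A X M (z ⊗ₜ m)) := by
  rw [leftAct_leftInduced]
  induction z with
  | zero => simp
  | add z w hz hw => simp_all [TensorProduct.add_tmul]
  | tmul b x => simp [TensorProduct.smul_tmul']

namespace IsTensorOver

variable {τ : X ⊗[k] M →ₗ[k] Y} (h : IsTensorOver (A := A) τ)
include h

theorem actionMap_lTensor (z : A ⊗[k] X) (m : M) :
    actionMap k A Y (τ.lTensor A (TensorProduct.assoc k A X M (z ⊗ₜ m))) =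
      τ (biActionMap k A X z ⊗ₜ m) := by
  induction z with
  | zero => simp
  | add z w hz hw => simp_all [TensorProduct.add_tmul]
  | tmul a x => simp [biActionMap_tmul, h.leftAct_tmul]

omit [IsScalarTower k A Y] in
theorem lTensor_assoc_rightAct (b : Aᵐᵒᵖ) (z : A ⊗[k] X) (m : M) :
    τ.lTensor A (TensorProduct.assoc k A X M (rightAct k A (LeftInduced k A X) b z ⊗ₜ m)) =
      τ.lTensor A (TensorProduct.assoc k A X M (z ⊗ₜ (b.unop • m))) := by
  rw [rightAct_leftInduced]
  induction z with
  | zero => simp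
  | add z w hz hw => simp_all [TensorProduct.add_tmul]
  | tmul b x => simp [h.rightAct_tmul]

theorem lTensor_mem_syzygy (w : BiSyzygy k A X ⊗[k] M) :
    τ.lTensor A (TensorProduct.assoc k A X M
      (((BiSyzygy k A X).subtype.restrictScalars k).rTensor M w)) ∈ Syzygy k A Y := by
  rw [LinearMap.mem_ker]
  induction w with
  | zero => simp
  | add z w hz hw => simp_all
  | tmul z m =>
    rw [LinearMap.rTensor_tmul, h.actionMap_lTensor]
    have : biActionMap k A X ((BiSyzygy k A X).subtype.restrictScalars k z) = 0 := z.2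
    simp [this, -LinearMap.coe_restrictScalars]

theorem syzygyTensorMap_proj (t : A ⊗[k] (X ⊗[k] M)) :
    syzygyTensorMap A τ ((biSyzygyProj k A X).rTensor M ((TensorProduct.assoc k A X M).symm t)) =
      syzygyProj k A Y (τ.lTensor A t) := by
  induction t with
  | zero => simp
  | add z w hz hw => simp_all
  | tmul a t =>
    induction t with
    | zero => simp
    | add z w hz hw => simp_all [TensorProduct.tmul_add]
    | tmul x m =>
      rw [TensorProduct.assoc_symm_tmul, LinearMap.rTensor_tmul, syzygyTensorMap_tmul,
        coe_biSyzygyProj, biActionMap_tmul, TensorProduct.sub_tmul, map_sub,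
        TensorProduct.assoc_tmul, TensorProduct.assoc_tmul, map_sub, LinearMap.lTensor_tmul,
        LinearMap.lTensor_tmul, h.leftAct_tmul]
      exact syzygyProj_coe k A Y (syzygyProj k A Y (a ⊗ₜ τ (x ⊗ₜ m)))

/-- The right linear splitting keeps the syzygy sequence of `X` exact after tensoring with `M`, and
`(A ⊗ X) ⊗_A M` is `A ⊗ Y`. -/
theorem syzygy :
    IsTensorOver (A := A) (X := BiSyzygy k A X) (Y := Syzygy k A Y) (syzygyTensorMap A τ) where
  surjective y := by
    obtain ⟨t, ht⟩ := LinearMap.lTensor_surjective A h.surjective (y : A ⊗[k] Y)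
    exact ⟨_, by rw [h.syzygyTensorMap_proj t, ht, syzygyProj_coe]⟩
  leftAct_tmul a z m := by
    apply Subtype.ext
    have h1 := h.lTensor_mem_syzygy (leftAct k A _ a z ⊗ₜ m)
    have h2 := h.lTensor_mem_syzygy (z ⊗ₜ m)
    rw [LinearMap.rTensor_tmul] at h1 h2
    rw [syzygyTensorMap_tmul, syzygyTensorMap_tmul, SetLike.val_smul]
    have e1 := congrArg Subtype.val (syzygyProj_coe k A Y ⟨_, h1⟩)
    have e2 := congrArg Subtype.val (syzygyProj_coe k A Y ⟨_, h2⟩)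
    refine e1.trans (Eq.trans ?_ (congrArg (a • ·) e2).symm)
    exact lTensor_assoc_leftAct τ a _ m
  rightAct_tmul b z m := congrArg (syzygyProj k A Y) (h.lTensor_assoc_rightAct b z m)
  ker_le := by
    intro w hw
    set t := TensorProduct.assoc k A X M
      (((BiSyzygy k A X).subtype.restrictScalars k).rTensor M w) with ht
    -- The retraction recovers `w` from its image `t` in `A ⊗ (X ⊗ M)`, so it is enough to show that
    -- it carries `A ⊗ ker τ` into the balanced relations.
    have hwt : (biSyzygyProj k A X).rTensor M ((TensorProduct.assoc k A X M).symm t) = w := by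
      rw [ht, LinearEquiv.symm_apply_apply, ← LinearMap.comp_apply, ← LinearMap.rTensor_comp]
      have : biSyzygyProj k A X ∘ₗ (BiSyzygy k A X).subtype.restrictScalars k = LinearMap.id :=
        LinearMap.ext (biSyzygyProj_coe k A X)
      rw [this, LinearMap.rTensor_id, LinearMap.id_apply]
    have h0 : τ.lTensor A t = 0 := by
      have e := congrArg Subtype.val (syzygyProj_coe k A Y ⟨_, h.lTensor_mem_syzygy w⟩)
      exact e.symm.trans (congrArg Subtype.val (LinearMap.mem_ker.1 hw))
    obtain ⟨s, hs⟩ := (lTensor_exact A τ.exact_subtype_ker_map h.surjective t).1 h0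
    rw [← hwt, ← hs]
    clear hwt h0 hs
    clear_value t
    induction s with
    | zero => simp
    | add z w hz hw => simp only [map_add]; exact add_mem hz hw
    | tmul a r =>
      obtain ⟨r, hr⟩ := r
      have hr' : r ∈ balancedRelations k A X M := h.ker_le hr
      have e : (biSyzygyProj k A X).rTensor M ((TensorProduct.assoc k A X M).symm (a ⊗ₜ r)) =
          (biSyzygyProj k A X ∘ₗ TensorProduct.mk k A X a).rTensor M r := by
        clear hr hr'
        induction r with
        | zero => simp
        | add z w hz hw => simp_all [TensorProduct.tmul_add]
        | tmul x m => rfl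
      rw [LinearMap.lTensor_tmul, Submodule.subtype_apply, e]
      -- For fixed `a`, the map sending `x` to the retraction of `a ⊗ x` is right linear, hence
      -- respects balanced relations.
      refine balancedRelations_le_comap (X' := BiSyzygy k A X) _ (fun b x => ?_) M hr'
      rw [LinearMap.comp_apply, LinearMap.comp_apply, ← biSyzygyProj_rightAct,
        rightAct_leftInduced]
      rfl

/-- If `X` is a projective bimodule then `X ⊗[A] M` is a projective left module. -/
theorem projective (hX : Module.Projective (Env k A) X) : Module.Projective A Y := by
  obtain ⟨s, hs⟩ := Module.projective_lifting_property (biActionMap k A X) LinearMap.id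
    (biActionMap_surjective k A X)
  -- The bimodule section `s`, tensored with `M`, should give a section of `A ⊗ Y → Y`; `f` is that
  -- section before descent along `τ`.
  let f : X ⊗[k] M →ₗ[k] A ⊗[k] Y := τ.lTensor A ∘ₗ (TensorProduct.assoc k A X M).toLinearMap ∘ₗ
    (s.restrictScalars k).rTensor M
  have hf (x : X) (m : M) :
      f (x ⊗ₜ m) = τ.lTensor A (TensorProduct.assoc k A X M ((s x : A ⊗[k] X) ⊗ₜ m)) := rfl
  have hker : LinearMap.ker τ ≤ LinearMap.ker f := by
    refine h.ker_le.trans (Submodule.span_le.2 ?_)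
    rintro _ ⟨b, x, m, rfl⟩
    rw [SetLike.mem_coe, LinearMap.sub_mem_ker_iff, hf, hf, LinearMap.map_rightAct,
      h.lTensor_assoc_rightAct]
  -- `σ` is only `k`-linear, but `f` vanishes on `ker τ`, so `f ∘ σ` does not depend on this choice
  -- and inherits `A`-linearity.
  obtain ⟨σ, hσ⟩ := τ.exists_rightInverse_of_surjective (LinearMap.range_eq_top.2 h.surjective)
  have hfσ (t : X ⊗[k] M) : f (σ (τ t)) = f t := by
    rw [← sub_eq_zero, ← map_sub]
    refine hker ?_
    rw [LinearMap.mem_ker, map_sub, ← LinearMap.comp_apply, hσ]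
    simp
  let g : Y →ₗ[A] A ⊗[k] Y :=
    { f ∘ₗ σ with
      map_smul' := fun a y => by
        obtain ⟨t, rfl⟩ := h.surjective y
        change f (σ (a • τ t)) = a • f (σ (τ t))
        rw [hfσ]
        induction t with
        | zero => simp
        | add z w hz hw => simp_all
        | tmul x m =>
          rw [← h.leftAct_tmul, hfσ, hf, hf, LinearMap.map_leftAct, lTensor_assoc_leftAct] }
  refine projective_of_section_actionMap k A Y g fun y => ?_
  obtain ⟨t, rfl⟩ := h.surjective y
  change actionMap k A Y (f (σ (τ t))) = τ t
  rw [hfσ]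
  induction t with
  | zero => simp
  | add z w hz hw => simp_all
  | tmul x m =>
    rw [hf, h.actionMap_lTensor]
    exact congrArg (fun x => τ (x ⊗ₜ m)) (LinearMap.congr_fun hs x)

end IsTensorOver

/-- Right projectivity is carried through the induction because it makes `A ⊗ X` a projective
bimodule, as dimension shifting requires. -/
theorem IsTensorOver.hasProjectiveDimensionLT (n : ℕ) :
    ∀ {X Y : Type u} [AddCommGroup X] [Module k X] [Module (Env k A) X]
      [IsScalarTower k (Env k A) X] [AddCommGroup Y] [Module k Y] [Module A Y]
      [IsScalarTower k A Y] {τ : X ⊗[k] M →ₗ[k] Y}, IsTensorOver (A := A) τ →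
      IsRightProjective k A X → HasProjectiveDimensionLT (ModuleCat.of (Env k A) X) n →
      HasProjectiveDimensionLT (ModuleCat.of A Y) n := by
  induction n with
  | zero =>
    intro X Y _ _ _ _ _ _ _ _ τ h _ hX
    rw [hasProjectiveDimensionLT_zero_iff] at hX ⊢
    have : Subsingleton (X ⊗[k] M) := inferInstance
    exact h.surjective.subsingleton
  | succ n ih =>
    intro X Y _ _ _ _ _ _ _ _ τ h hr hX
    cases n with
    | zero =>
      rw [zero_add, hasProjectiveDimensionLT_one_iff] at hX ⊢
      exact h.projective hX
    | succ n =>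
      have := hr.projective_leftInduced
      rw [hasProjectiveDimensionLT_ker_iff (biActionMap k A X) (biActionMap_surjective k A X)] at hX
      rw [hasProjectiveDimensionLT_ker_iff (actionMap k A Y) (actionMap_surjective k A Y)]
      exact ih h.syzygy hr.biSyzygy hX

end TensorOverAlgebra

/-! ### The regular bimodule -/

section Regular

variable (k : Type v) [Field k] (A : Type u) [Ring A] [Algebra k A]

attribute [local instance] TensorProduct.Algebra.module

theorem isScalarTower_env_self : IsScalarTower k (Env k A) A where
  smul_assoc r c x := by
    change TensorProduct.Algebra.moduleAux (r • c) x = r • TensorProduct.Algebra.moduleAux c x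
    rw [map_smul, LinearMap.smul_apply]

attribute [local instance] isScalarTower_env_self

theorem leftAct_self (a x : A) : leftAct k A A a x = a * x := by
  change (a ⊗ₜ[k] 1 : Env k A) • x = _
  rw [TensorProduct.Algebra.smul_def, one_smul, smul_eq_mul]

theorem rightAct_self (b : Aᵐᵒᵖ) (x : A) : rightAct k A A b x = x * b.unop := by
  change (1 ⊗ₜ[k] b : Env k A) • x = _
  rw [TensorProduct.Algebra.smul_def, one_smul]
  rfl

theorem isRightProjective_self : IsRightProjective k A A := by
  refine ⟨(TensorProduct.mk k Aᵐᵒᵖ A).flip 1 ∘ₗ (MulOpposite.opLinearEquiv k).toLinearMap,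
    fun b x => ?_, fun x => ?_⟩
  · simp [rightAct_self, TensorProduct.smul_tmul']
  · simp [rightAct_self]

theorem isTensorOver_self (M : Type u) [AddCommGroup M] [Module k M] [Module A M]
    [IsScalarTower k A M] :
    IsTensorOver (A := A) ((actionMap k A M).restrictScalars k) where
  surjective := actionMap_surjective k A M
  leftAct_tmul a x m := by simp [leftAct_self, mul_smul]
  rightAct_tmul b x m := by simp [rightAct_self, mul_smul]
  ker_le t ht := by
    -- Moving scalars across the tensor sign reduces every `t` to `1 ⊗ m`, where `m` is the image of
    -- `t`; so an element of the kernel is itself a relation.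
    have key (t : A ⊗[k] M) :
        t - 1 ⊗ₜ actionMap k A M t ∈ balancedRelations k A A M := by
      induction t with
      | zero => simp
      | add z w hz hw => simpa [TensorProduct.tmul_add, add_sub_add_comm] using add_mem hz hw
      | tmul a m => exact Submodule.subset_span ⟨.op a, 1, m, by simp [rightAct_self]⟩
    have ht' : actionMap k A M t = 0 := ht
    simpa [ht'] using key t

theorem projectiveDimension_le_hochschildDimension (M : ModuleCat.{u} A) :
    projectiveDimension M ≤ hochschildDimension k A := by
  let : Module k M := Module.compHom M (algebraMap k A)
  have : IsScalarTower k A M := ⟨fun r a m => by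
    rw [Algebra.smul_def, mul_smul]; rfl⟩
  exact projectiveDimension_le_of_forall fun n h =>
    (isTensorOver_self k A M).hasProjectiveDimensionLT n (isRightProjective_self k A) h

theorem leftGlobalDimension_le_hochschildDimension :
    leftGlobalDimension A ≤ hochschildDimension k A :=
  iSup_le (projectiveDimension_le_hochschildDimension k A)

end Regular

/-! ### Gradings of vector spaces -/

/-- An `ℕ`-grading of a vector space, given by the projections onto the components. -/
structure LinearGrading (k : Type v) [Field k] (X : Type u) [AddCommGroup X] [Module k X] where
  /-- the projection onto the component of degree `i` -/
  proj : ℕ → X →ₗ[k] X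
  proj_proj : ∀ i j x, proj i (proj j x) = if i = j then proj j x else 0
  iSup_range : ⨆ i, LinearMap.range (proj i) = ⊤

namespace LinearGrading

variable {k : Type v} [Field k]
variable {X : Type u} [AddCommGroup X] [Module k X] {Y : Type u} [AddCommGroup Y] [Module k Y]

/-- A family of endomorphisms which acts on a spanning set as projections onto components is a
grading. -/
def ofSpan (p : ℕ → X →ₗ[k] X) (S : Set X) (hS : Submodule.span k S = ⊤)
    (h : ∀ s ∈ S, ∃ n, ∀ i, p i s = if i = n then s else 0) : LinearGrading k X where
  proj := p
  proj_proj i j x := by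
    have hx : x ∈ Submodule.span k S := hS ▸ Submodule.mem_top
    induction hx using Submodule.span_induction with
    | zero => simp
    | add x y _ _ hx hy => rw [map_add, map_add, hx, hy]; split_ifs <;> simp
    | smul c x _ hx => rw [map_smul, map_smul, hx]; split_ifs <;> simp
    | mem s hs =>
      obtain ⟨n, hn⟩ := h s hs
      rw [hn j]
      by_cases hj : j = n
      · simp [hj, hn]
      · simp [hj]
  iSup_range := by
    rw [eq_top_iff, ← hS, Submodule.span_le]
    intro s hs
    obtain ⟨n, hn⟩ := h s hs
    exact Submodule.mem_iSup_of_mem n ⟨s, by simp [hn]⟩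

variable (g : LinearGrading k X)

theorem induction {P : X → Prop} (x : X) (zero : P 0) (add : ∀ x y, P x → P y → P (x + y))
    (proj : ∀ i x, P (g.proj i x)) : P x := by
  have hx : x ∈ ⨆ i, LinearMap.range (g.proj i) := g.iSup_range ▸ Submodule.mem_top
  refine Submodule.iSup_induction _ (motive := P) hx ?_ zero add
  rintro i _ ⟨x, rfl⟩
  exact proj i x

/-- Asking for every larger finite set allows the sets attached to two vectors to be replaced by
their union. -/
theorem exists_sum_proj (x : X) : ∃ s : Finset ℕ, ∀ t, s ⊆ t → ∑ i ∈ t, g.proj i x = x := by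
  classical
  induction x using g.induction with
  | zero => exact ⟨∅, by simp⟩
  | add x y hx hy =>
    obtain ⟨s, hs⟩ := hx
    obtain ⟨t, ht⟩ := hy
    refine ⟨s ∪ t, fun r hr => ?_⟩
    simp only [map_add, Finset.sum_add_distrib]
    rw [hs r (Finset.union_subset_left hr), ht r (Finset.union_subset_right hr)]
  | proj i x =>
    refine ⟨{i}, fun t ht => ?_⟩
    simp only [g.proj_proj, Finset.sum_ite_eq']
    rw [if_pos (ht (Finset.mem_singleton_self i))]

theorem eq_zero_of_proj {x : X} (h : ∀ i, g.proj i x = 0) : x = 0 := by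
  obtain ⟨s, hs⟩ := g.exists_sum_proj x
  rw [← hs s subset_rfl]
  exact Finset.sum_eq_zero fun i _ => h i

theorem finite_support_proj (x : X) : (Function.support fun i => g.proj i x).Finite := by
  induction x using g.induction with
  | zero => simp
  | add x y hx hy =>
    refine (hx.union hy).subset ?_
    simp only [map_add]
    exact Function.support_add _ _
  | proj i x =>
    refine (Set.finite_singleton i).subset fun j hj => ?_
    by_contra h
    exact hj ((g.proj_proj j i x).trans (if_neg h))

/-- The decomposition of a vector into its components. -/
noncomputable def decompose : X →ₗ[k] ℕ →₀ X where
  toFun x := Finsupp.ofSupportFinite (fun i => g.proj i x) (g.finite_support_proj x)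
  map_add' x y := Finsupp.ext fun i => map_add (g.proj i) x y
  map_smul' c x := Finsupp.ext fun i => map_smul (g.proj i) c x

theorem decompose_proj (i : ℕ) (x : X) : g.decompose (g.proj i x) = Finsupp.single i (g.proj i x) :=
  Finsupp.ext fun j => by
    rw [Finsupp.single_apply]
    exact (g.proj_proj j i x).trans (by simp only [eq_comm])

/-- The component of degree `0` of an endomorphism. -/
noncomputable def degreeZeroPart (e : X →ₗ[k] X) : X →ₗ[k] X :=
  Finsupp.lsum k (fun i => g.proj i ∘ₗ e) ∘ₗ g.decompose

theorem degreeZeroPart_proj (e : X →ₗ[k] X) (i : ℕ) (x : X) :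
    g.degreeZeroPart e (g.proj i x) = g.proj i (e (g.proj i x)) := by
  simp [degreeZeroPart, decompose_proj]

/-- The grading of an equivalent vector space. -/
def congr (e : X ≃ₗ[k] Y) : LinearGrading k Y :=
  ofSpan (fun i => e.toLinearMap ∘ₗ g.proj i ∘ₗ e.symm.toLinearMap)
    {y | ∃ i x, y = e (g.proj i x)}
    (by
      rw [eq_top_iff]
      intro y _
      obtain ⟨x, rfl⟩ := e.surjective y
      induction x using g.induction with
      | zero => simp
      | add x y hx hy => rw [map_add]; exact add_mem (hx trivial) (hy trivial)
      | proj i x => exact Submodule.subset_span ⟨i, x, rfl⟩)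
    (by
      rintro _ ⟨i, x, rfl⟩
      refine ⟨i, fun j => ?_⟩
      simp only [LinearMap.comp_apply, LinearEquiv.coe_coe, LinearEquiv.symm_apply_apply,
        g.proj_proj]
      split_ifs <;> simp)

/-- The grading of a submodule which is stable under the projections. -/
def restrict {B : Type*} [Ring B] [Algebra k B] [Module B X] [IsScalarTower k B X]
    (S : Submodule B X) (hS : ∀ i, ∀ x ∈ S, g.proj i x ∈ S) : LinearGrading k S where
  proj i := (g.proj i ∘ₗ S.subtype.restrictScalars k).codRestrict (S.restrictScalars k)
    (fun x => hS i x x.2)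
  proj_proj i j x := Subtype.ext ((g.proj_proj i j x).trans (by split_ifs <;> rfl))
  iSup_range := by
    rw [eq_top_iff]
    intro x _
    obtain ⟨s, hs⟩ := g.exists_sum_proj (x : X)
    have : x = ∑ i ∈ s, (g.proj i ∘ₗ S.subtype.restrictScalars k).codRestrict (S.restrictScalars k)
        (fun x => hS i x x.2) x := Subtype.ext (by
      rw [AddSubmonoidClass.coe_finsetSum]
      exact (hs s subset_rfl).symm)
    rw [this]
    exact sum_mem fun i _ => Submodule.mem_iSup_of_mem i ⟨x, rfl⟩

variable (h : LinearGrading k Y)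

theorem sum_antidiagonal_map_proj (n i j : ℕ) (x : X) (y : Y) :
    (∑ p ∈ Finset.HasAntidiagonal.antidiagonal n, TensorProduct.map (g.proj p.1) (h.proj p.2))
      (g.proj i x ⊗ₜ[k] h.proj j y) = if n = i + j then g.proj i x ⊗ₜ[k] h.proj j y else 0 := by
  simp only [LinearMap.sum_apply, TensorProduct.map_tmul, g.proj_proj, h.proj_proj]
  split_ifs with hn
  · rw [Finset.sum_eq_single (i, j)]
    · simp
    · rintro ⟨a, b⟩ _ hab
      by_cases ha : a = i
      · have hb : b ≠ j := fun hb => hab (by rw [ha, hb])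
        simp [hb]
      · simp [ha]
    · intro hmem
      exact (hmem (Finset.HasAntidiagonal.mem_antidiagonal.2 hn.symm)).elim
  · refine Finset.sum_eq_zero fun p hp => ?_
    rw [Finset.HasAntidiagonal.mem_antidiagonal] at hp
    by_cases ha : p.1 = i
    · have hb : p.2 ≠ j := fun hb => hn (by rw [← hp, ha, hb])
      simp [hb]
    · simp [ha]

/-- The total grading of a tensor product. -/
def tensor : LinearGrading k (X ⊗[k] Y) :=
  ofSpan (fun n => ∑ p ∈ Finset.HasAntidiagonal.antidiagonal n, TensorProduct.map (g.proj p.1) (h.proj p.2))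
    {z | ∃ i x j y, z = g.proj i x ⊗ₜ h.proj j y}
    (by
      rw [eq_top_iff]
      rintro z -
      induction z with
      | zero => simp
      | add z w hz hw => exact add_mem hz hw
      | tmul x y =>
        induction x using g.induction with
        | zero => simp
        | add x x' hx hx' => rw [TensorProduct.add_tmul]; exact add_mem hx hx'
        | proj i x =>
          induction y using h.induction with
          | zero => simp
          | add y y' hy hy' => rw [TensorProduct.tmul_add]; exact add_mem hy hy'
          | proj j y => exact Submodule.subset_span ⟨i, x, j, y, rfl⟩)
    (by
      rintro _ ⟨i, x, j, y, rfl⟩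
      exact ⟨i + j, fun n => g.sum_antidiagonal_map_proj h n i j x y⟩)

theorem tensor_proj_tmul (n i j : ℕ) (x : X) (y : Y) :
    (g.tensor h).proj n (g.proj i x ⊗ₜ[k] h.proj j y) =
      if n = i + j then g.proj i x ⊗ₜ[k] h.proj j y else 0 :=
  g.sum_antidiagonal_map_proj h n i j x y

theorem tensor_induction {P : X ⊗[k] Y → Prop} (z : X ⊗[k] Y) (zero : P 0)
    (add : ∀ x y, P x → P y → P (x + y))
    (tmul : ∀ i x j y, P (g.proj i x ⊗ₜ h.proj j y)) : P z := by
  induction z with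
  | zero => exact zero
  | add z w hz hw => exact add z w hz hw
  | tmul x y =>
    induction x using g.induction with
    | zero => simpa using zero
    | add x x' hx hx' => rw [TensorProduct.add_tmul]; exact add _ _ hx hx'
    | proj i x =>
      induction y using h.induction with
      | zero => simpa using zero
      | add y y' hy hy' => rw [TensorProduct.tmul_add]; exact add _ _ hy hy'
      | proj j y => exact tmul i x j y

/-- `Y` carries no grading: only the degree of the first factor counts. -/
theorem eq_zero_of_rTensor_proj {z : X ⊗[k] Y} (hz : ∀ i, (g.proj i).rTensor Y z = 0) : z = 0 := by
  have key (z : X ⊗[k] Y) : ∃ s : Finset ℕ, ∀ t, s ⊆ t → ∑ i ∈ t, (g.proj i).rTensor Y z = z := by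
    classical
    induction z with
    | zero => exact ⟨∅, by simp⟩
    | add x y hx hy =>
      obtain ⟨s, hs⟩ := hx
      obtain ⟨t, ht⟩ := hy
      refine ⟨s ∪ t, fun r hr => ?_⟩
      simp only [map_add, Finset.sum_add_distrib]
      rw [hs r (Finset.union_subset_left hr), ht r (Finset.union_subset_right hr)]
    | tmul x y =>
      obtain ⟨s, hs⟩ := g.exists_sum_proj x
      refine ⟨s, fun t ht => ?_⟩
      simp only [LinearMap.rTensor_tmul]
      rw [← TensorProduct.sum_tmul, hs t ht]
  obtain ⟨s, hs⟩ := key z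
  rw [← hs s subset_rfl]
  exact Finset.sum_eq_zero fun i _ => hz i

end LinearGrading

/-! ### Connected graded algebras and graded bimodules -/

/-- An algebra grading with `A_0` consisting of scalars. -/
structure ConnectedGrading (k : Type v) [Field k] (A : Type u) [Ring A] [Algebra k A] extends
    LinearGrading k A where
  proj_mul : ∀ i j a b, proj (i + j) (proj i a * proj j b) = proj i a * proj j b
  proj_zero : ∀ a, ∃ c : k, proj 0 a = algebraMap k A c

/-- The grading of the opposite algebra. -/
def ConnectedGrading.op {k : Type v} [Field k] {A : Type u} [Ring A] [Algebra k A]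
    (G : ConnectedGrading k A) : ConnectedGrading k Aᵐᵒᵖ where
  toLinearGrading := G.toLinearGrading.congr (MulOpposite.opLinearEquiv k)
  proj_mul i j a b := by
    change MulOpposite.op (G.proj (i + j) (G.proj j b.unop * G.proj i a.unop)) =
      MulOpposite.op (G.proj j b.unop * G.proj i a.unop)
    rw [add_comm, G.proj_mul]
  proj_zero a := by
    obtain ⟨c, hc⟩ := G.proj_zero a.unop
    exact ⟨c, congrArg MulOpposite.op hc⟩

theorem ConnectedGrading.op_proj {k : Type v} [Field k] {A : Type u} [Ring A] [Algebra k A]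
    (G : ConnectedGrading k A) (i : ℕ) (a : Aᵐᵒᵖ) :
    G.op.proj i a = MulOpposite.op (G.proj i a.unop) := rfl

theorem ConnectedGrading.proj_proj_mul {k : Type v} [Field k] {A : Type u} [Ring A] [Algebra k A]
    (G : ConnectedGrading k A) (d i : ℕ) (a b : A) :
    G.proj d (G.proj i a * b) = if i ≤ d then G.proj i a * G.proj (d - i) b else 0 := by
  induction b using G.induction with
  | zero => simp
  | add x y hx hy => rw [mul_add, map_add, hx, hy, map_add, mul_add]; split_ifs <;> simp
  | proj j x =>
    rw [← G.proj_mul, G.proj_proj, G.proj_mul, G.proj_proj]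
    by_cases h : d = i + j
    · simp [h]
    · have : i ≤ d → d - i ≠ j := by omega
      split_ifs <;> simp_all

section GradedBimodule

variable {k : Type v} [Field k] {A : Type u} [Ring A] [Algebra k A] (G : ConnectedGrading k A)
variable {X : Type u} [AddCommGroup X] [Module k X] [Module (Env k A) X]
  [IsScalarTower k (Env k A) X]
variable {Y : Type u} [AddCommGroup Y] [Module k Y] [Module A Y] [IsScalarTower k A Y]

/-- A grading of a bimodule which is compatible with both actions of `A`. -/
structure IsBimoduleGrading (g : LinearGrading k X) : Prop where
  leftAct : ∀ i j a x, g.proj (i + j) (leftAct k A X (G.proj i a) (g.proj j x)) =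
    leftAct k A X (G.proj i a) (g.proj j x)
  rightAct : ∀ i j b x, g.proj (i + j) (rightAct k A X (G.op.proj i b) (g.proj j x)) =
    rightAct k A X (G.op.proj i b) (g.proj j x)

namespace IsBimoduleGrading

variable {G} {g : LinearGrading k X} (hg : IsBimoduleGrading G g)
include hg

theorem proj_leftAct (d i : ℕ) (a : A) (x : X) :
    g.proj d (_root_.leftAct k A X (G.proj i a) x) =
      if i ≤ d then _root_.leftAct k A X (G.proj i a) (g.proj (d - i) x) else 0 := by
  induction x using g.induction with
  | zero => simp
  | add x y hx hy => rw [map_add, map_add, hx, hy]; split_ifs <;> simp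
  | proj j x =>
    rw [← hg.leftAct, g.proj_proj, hg.leftAct, g.proj_proj]
    by_cases h : d = i + j
    · simp [h]
    · have : i ≤ d → d - i ≠ j := by omega
      split_ifs <;> simp_all

theorem proj_rightAct (d i : ℕ) (b : Aᵐᵒᵖ) (x : X) :
    g.proj d (_root_.rightAct k A X (G.op.proj i b) x) =
      if i ≤ d then _root_.rightAct k A X (G.op.proj i b) (g.proj (d - i) x) else 0 := by
  induction x using g.induction with
  | zero => simp
  | add x y hx hy => rw [map_add, map_add, hx, hy]; split_ifs <;> simp
  | proj j x =>
    rw [← hg.rightAct, g.proj_proj, hg.rightAct, g.proj_proj]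
    by_cases h : d = i + j
    · simp [h]
    · have : i ≤ d → d - i ≠ j := by omega
      split_ifs <;> simp_all

/-- The action map has degree `0`, which is why its kernel is a graded bimodule. -/
theorem biActionMap_proj (n : ℕ) (z : A ⊗[k] X) :
    biActionMap k A X ((G.tensor g).proj n z) = g.proj n (biActionMap k A X z) := by
  induction z using G.tensor_induction g with
  | zero => simp
  | add z w hz hw => simp only [map_add, hz, hw]
  | tmul i a j x =>
    rw [LinearGrading.tensor_proj_tmul, biActionMap_tmul, ← hg.leftAct, g.proj_proj, hg.leftAct]
    split_ifs
    · rfl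
    · simp

theorem leftInduced : IsBimoduleGrading (X := LeftInduced k A X) G (G.tensor g) where
  leftAct i j a z := by
    rw [leftAct_leftInduced]
    induction z using G.tensor_induction g with
    | zero => simp
    | add z w hz hw => simp only [map_add, hz, hw]
    | tmul l b m x =>
      rw [LinearGrading.tensor_proj_tmul]
      split_ifs with h
      · rw [TensorProduct.map_tmul, LinearMap.id_apply]
        change (G.tensor g).proj (i + j) ((G.proj i a * G.proj l b) ⊗ₜ[k] g.proj m x) =
          (G.proj i a * G.proj l b) ⊗ₜ[k] g.proj m x
        rw [← G.proj_mul, LinearGrading.tensor_proj_tmul, if_pos (by omega)]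
      · simp
  rightAct i j b z := by
    rw [rightAct_leftInduced]
    induction z using G.tensor_induction g with
    | zero => simp
    | add z w hz hw => simp only [map_add, hz, hw]
    | tmul l a m x =>
      rw [LinearGrading.tensor_proj_tmul]
      split_ifs with h
      · rw [TensorProduct.map_tmul, LinearMap.id_apply, ← hg.rightAct,
          LinearGrading.tensor_proj_tmul, if_pos (by omega)]
      · simp

theorem proj_mem_biSyzygy (i : ℕ) (z : LeftInduced k A X) (hz : z ∈ BiSyzygy k A X) :
    (G.tensor g).proj i z ∈ BiSyzygy k A X := by
  rw [LinearMap.mem_ker] at hz ⊢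
  rw [hg.biActionMap_proj, hz, map_zero]

theorem biSyzygy :
    IsBimoduleGrading (X := BiSyzygy k A X) G ((G.tensor g).restrict _ hg.proj_mem_biSyzygy) where
  leftAct i j a z := Subtype.ext (hg.leftInduced.leftAct i j a z)
  rightAct i j b z := Subtype.ext (hg.leftInduced.rightAct i j b z)

end IsBimoduleGrading

variable (X) in
/-- The subspace `X A_+` of a bimodule `X`. -/
def rightRadical : Submodule k X :=
  Submodule.span k {z | ∃ i b x, z = rightAct k A X (G.op.proj (i + 1) b) x}

theorem rightRadical_le_comap {X' : Type u} [AddCommGroup X'] [Module k X'] [Module (Env k A) X']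
    [IsScalarTower k (Env k A) X'] (f : X →ₗ[k] X')
    (hf : ∀ b x, f (rightAct k A X b x) = rightAct k A X' b (f x)) :
    rightRadical G X ≤ (rightRadical G X').comap f := by
  refine Submodule.span_le.2 ?_
  rintro _ ⟨i, b, x, rfl⟩
  rw [SetLike.mem_coe, Submodule.mem_comap, hf]
  exact Submodule.subset_span ⟨i, b, f x, rfl⟩

/-- The map `q` exhibits the left module `Y` as the quotient `X / X A_+`. -/
structure IsRightReduction (q : X →ₗ[k] Y) : Prop where
  surjective : Function.Surjective q
  map_leftAct : ∀ a x, q (leftAct k A X a x) = a • q x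
  map_rightAct : ∀ i b x, q (rightAct k A X (G.op.proj (i + 1) b) x) = 0
  ker_le : LinearMap.ker q ≤ rightRadical G X

variable (A) in
/-- The map induced on syzygies by a map `X → Y`. -/
def syzygyMap (q : X →ₗ[k] Y) : BiSyzygy k A X →ₗ[k] Syzygy k A Y :=
  syzygyProj k A Y ∘ₗ q.lTensor A ∘ₗ (BiSyzygy k A X).subtype.restrictScalars k

theorem syzygyMap_apply (q : X →ₗ[k] Y) (z : BiSyzygy k A X) :
    syzygyMap A q z = syzygyProj k A Y (q.lTensor A (z : A ⊗[k] X)) := rfl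

namespace IsRightReduction

variable {G} {q : X →ₗ[k] Y} (h : IsRightReduction G q)
include h

theorem actionMap_lTensor (z : A ⊗[k] X) :
    actionMap k A Y (q.lTensor A z) = q (biActionMap k A X z) := by
  induction z with
  | zero => simp
  | add z w hz hw => simp_all
  | tmul a x => simp [biActionMap_tmul, h.map_leftAct]

theorem coe_syzygyMap (z : BiSyzygy k A X) :
    (syzygyMap A q z : A ⊗[k] Y) = q.lTensor A (z : A ⊗[k] X) := by
  rw [syzygyMap_apply, coe_syzygyProj, h.actionMap_lTensor, LinearMap.mem_ker.1 z.2]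
  simp

/-- The analogue of `IsTensorOver.syzygy` for reduction modulo `X A_+`: the right linear retraction
sends `A ⊗ X A_+` into ΩX · A_+. -/
theorem syzygy :
    IsRightReduction (X := BiSyzygy k A X) (Y := Syzygy k A Y) G (syzygyMap A q) where
  surjective y := by
    obtain ⟨t, ht⟩ := LinearMap.lTensor_surjective A h.surjective (y : A ⊗[k] Y)
    refine ⟨biSyzygyProj k A X t, Subtype.ext ?_⟩
    rw [h.coe_syzygyMap, coe_biSyzygyProj, map_sub, ht, LinearMap.lTensor_tmul,
      ← h.actionMap_lTensor, ht, LinearMap.mem_ker.1 y.2, TensorProduct.tmul_zero, sub_zero]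
  map_leftAct a z := by
    apply Subtype.ext
    rw [SetLike.val_smul, h.coe_syzygyMap, h.coe_syzygyMap, coe_leftAct, leftAct_leftInduced]
    generalize (z : A ⊗[k] X) = z
    induction z using TensorProduct.induction_on with
    | zero => simp
    | add z w hz hw => simp_all
    | tmul b x => simp [TensorProduct.smul_tmul']
  map_rightAct i b z := by
    apply Subtype.ext
    rw [h.coe_syzygyMap, coe_rightAct, rightAct_leftInduced]
    generalize (z : A ⊗[k] X) = z
    induction z using TensorProduct.induction_on with
    | zero => simp
    | add z w hz hw => simp_all
    | tmul b x => simp [h.map_rightAct]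
  ker_le := by
    intro z hz
    have h0 : q.lTensor A (z : A ⊗[k] X) = 0 := by
      rw [← h.coe_syzygyMap, LinearMap.mem_ker.1 hz]; rfl
    obtain ⟨s, hs⟩ := (lTensor_exact A q.exact_subtype_ker_map h.surjective _).1 h0
    rw [← biSyzygyProj_coe k A X z, ← hs]
    clear hz h0 hs
    induction s with
    | zero => simp
    | add z w hz hw => simp only [map_add]; exact add_mem hz hw
    | tmul a r =>
      refine rightRadical_le_comap G (X' := BiSyzygy k A X)
        (biSyzygyProj k A X ∘ₗ TensorProduct.mk k A X a) (fun b x => ?_) (h.ker_le r.2)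
      rw [LinearMap.comp_apply, LinearMap.comp_apply, ← biSyzygyProj_rightAct,
        rightAct_leftInduced]
      rfl

end IsRightReduction

end GradedBimodule

/-! ### Graded Nakayama and lifting projectivity from `X / X A_+` to `X` -/

section GradedBimodule

variable {k : Type v} [Field k] {A : Type u} [Ring A] [Algebra k A] {G : ConnectedGrading k A}
variable {X : Type u} [AddCommGroup X] [Module k X] [Module (Env k A) X]
  [IsScalarTower k (Env k A) X]
variable {Y : Type u} [AddCommGroup Y] [Module k Y] [Module A Y] [IsScalarTower k A Y]
variable {g : LinearGrading k X} {q : X →ₗ[k] Y}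

namespace IsBimoduleGrading

variable (hg : IsBimoduleGrading G g)
include hg

/-- In a product of degree `d` whose right factor has positive degree, the other factor has degree
`j < d`. This drop drives the Nakayama-type inductions. -/
theorem proj_mem_rightRadical (d : ℕ) {x : X} (hx : x ∈ rightRadical G X) :
    g.proj d x ∈ Submodule.span k {z | ∃ i j b y, i + 1 + j = d ∧
      z = _root_.rightAct k A X (G.op.proj (i + 1) b) (g.proj j y)} := by
  rw [rightRadical] at hx
  induction hx using Submodule.span_induction with
  | zero => simp
  | add x y _ _ hx hy => rw [map_add]; exact add_mem hx hy
  | smul c x _ hx => rw [map_smul]; exact Submodule.smul_mem _ c hx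
  | mem z hz =>
    obtain ⟨i, b, x, rfl⟩ := hz
    rw [hg.proj_rightAct]
    split_ifs with hi
    · exact Submodule.subset_span ⟨i, d - (i + 1), b, x, by omega, rfl⟩
    · exact zero_mem _

theorem proj_mem_rightRadical' (d : ℕ) {x : X} (hx : x ∈ rightRadical G X) :
    g.proj d x ∈ rightRadical G X := by
  refine Submodule.span_mono ?_ (hg.proj_mem_rightRadical d hx)
  rintro _ ⟨i, j, b, y, -, rfl⟩
  exact ⟨i, b, _, rfl⟩

/-- A graded version of Nakayama's lemma. -/
theorem subsingleton_of_rightRadical_eq_top (h : rightRadical G X = ⊤) : Subsingleton X := by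
  have key (d : ℕ) : ∀ x, g.proj d x = 0 := by
    induction d using Nat.strong_induction_on with
    | _ d ih =>
      intro x
      have hx := hg.proj_mem_rightRadical d (x := x) (h ▸ Submodule.mem_top)
      refine (Submodule.mem_bot k).1 (Submodule.span_le.2 ?_ hx)
      rintro _ ⟨i, j, b, y, hd, rfl⟩
      rw [ih j (by omega), map_zero]
      exact zero_mem _
  exact subsingleton_of_forall_eq 0 fun x => g.eq_zero_of_proj fun d => key d x

end IsBimoduleGrading

namespace IsRightReduction

variable (h : IsRightReduction G q)
include h

omit [IsScalarTower k A Y] in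
theorem mem_rightRadical_iff {x : X} : x ∈ rightRadical G X ↔ q x = 0 := by
  refine ⟨fun hx => ?_, fun hx => h.ker_le hx⟩
  refine (Submodule.span_le (p := LinearMap.ker q)).2 ?_ hx
  rintro _ ⟨i, b, x, rfl⟩
  exact h.map_rightAct i b x

omit [IsScalarTower k A Y] in
theorem subsingleton (hg : IsBimoduleGrading G g) [Subsingleton Y] : Subsingleton X :=
  hg.subsingleton_of_rightRadical_eq_top
    (eq_top_iff.2 fun _ _ => h.mem_rightRadical_iff.2 (Subsingleton.elim _ _))

/-- If `Y = X / X A_+` is projective, then the projection `X → Y` has a left linear section. -/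
theorem exists_section [Module.Projective A Y] :
    ∃ σ : Y →ₗ[k] X, (∀ a y, σ (a • y) = leftAct k A X a (σ y)) ∧ ∀ y, q (σ y) = y := by
  obtain ⟨t, ht⟩ := exists_section_actionMap k A Y
  obtain ⟨σ, hσ⟩ := q.exists_rightInverse_of_surjective (LinearMap.range_eq_top.2 h.surjective)
  replace hσ (y : Y) : q (σ y) = y := LinearMap.congr_fun hσ y
  refine ⟨(biActionMap k A X).restrictScalars k ∘ₗ σ.lTensor A ∘ₗ t.restrictScalars k,
    fun a y => ?_, fun y => ?_⟩
  · simp only [LinearMap.comp_apply, LinearMap.restrictScalars_apply, map_smul]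
    rw [← LinearMap.map_leftAct, leftAct_leftInduced]
    generalize t y = z
    induction z using TensorProduct.induction_on with
    | zero => simp
    | add z w hz hw => simp_all
    | tmul b y => simp [TensorProduct.smul_tmul']
  · simp only [LinearMap.comp_apply, LinearMap.restrictScalars_apply]
    conv_rhs => rw [← ht y]
    generalize t y = z
    induction z using TensorProduct.induction_on with
    | zero => simp
    | add z w hz hw => simp_all
    | tmul b y => simp [biActionMap_tmul, h.map_leftAct, hσ]

/-- If `Y = X / X A_+` is projective, then the projection `X → Y` has a left linear section such
that the induced endomorphism of `X` is homogeneous of degree `0`. -/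
theorem exists_homogeneous_section (hg : IsBimoduleGrading G g) [Module.Projective A Y] :
    ∃ σ : Y →ₗ[k] X, (∀ a y, σ (a • y) = leftAct k A X a (σ y)) ∧ (∀ y, q (σ y) = y) ∧
      ∀ i x, g.proj i (σ (q (g.proj i x))) = σ (q (g.proj i x)) := by
  obtain ⟨σ, hσl, hσ⟩ := h.exists_section
  obtain ⟨τ, hτ⟩ := q.exists_rightInverse_of_surjective (LinearMap.range_eq_top.2 h.surjective)
  replace hτ (y : Y) : q (τ y) = y := LinearMap.congr_fun hτ y
  -- `σ ∘ q` is left linear but perhaps not homogeneous. Its degree `0` part `e` is still left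
  -- linear with `q ∘ e = q`, and it kills `X A_+` because that subspace is graded. So `e` descends
  -- to `Y`, and `e ∘ τ` is the section sought.
  set e := g.degreeZeroPart (σ ∘ₗ q) with he
  have e_proj (i : ℕ) (x : X) : e (g.proj i x) = g.proj i (σ (q (g.proj i x))) :=
    g.degreeZeroPart_proj _ i x
  have e_rad {x : X} (hx : q x = 0) : e x = 0 := by
    have hx' := h.mem_rightRadical_iff.2 hx
    obtain ⟨s, hs⟩ := g.exists_sum_proj x
    rw [← hs s subset_rfl, map_sum]
    refine Finset.sum_eq_zero fun i _ => ?_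
    rw [e_proj, h.mem_rightRadical_iff.1 (hg.proj_mem_rightRadical' i hx'), map_zero, map_zero]
  have q_e (x : X) : q (e x) = q x := by
    induction x using g.induction with
    | zero => simp
    | add x y hx hy => simp only [map_add, hx, hy]
    | proj i x =>
      rw [e_proj, ← sub_eq_zero, ← map_sub, ← h.mem_rightRadical_iff]
      have : σ (q (g.proj i x)) - g.proj i x ∈ rightRadical G X := by
        rw [h.mem_rightRadical_iff, map_sub, hσ, sub_self]
      simpa [g.proj_proj] using hg.proj_mem_rightRadical' i this
  have e_left (a : A) (x : X) : e (leftAct k A X a x) = leftAct k A X a (e x) := by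
    induction a using G.induction with
    | zero => simp
    | add a b ha hb => simp only [map_add, LinearMap.add_apply, ha, hb]
    | proj i a =>
      induction x using g.induction with
      | zero => simp
      | add x y hx hy => simp only [map_add, hx, hy]
      | proj j x =>
        rw [← hg.leftAct, e_proj, hg.leftAct, h.map_leftAct, hσl, hg.proj_leftAct,
          if_pos (Nat.le_add_right i j), Nat.add_sub_cancel_left, e_proj]
  have e_τ (x : X) : e (τ (q x)) = e x := by
    rw [← sub_eq_zero, ← map_sub]
    exact e_rad (by rw [map_sub, hτ, sub_self])
  refine ⟨e ∘ₗ τ, fun a y => ?_, fun y => ?_, fun i x => ?_⟩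
  · obtain ⟨x, rfl⟩ := h.surjective y
    rw [LinearMap.comp_apply, LinearMap.comp_apply, ← h.map_leftAct, e_τ, e_τ, e_left]
  · rw [LinearMap.comp_apply, q_e, hτ]
  · rw [LinearMap.comp_apply, e_τ, e_proj, g.proj_proj, if_pos rfl]

end IsRightReduction

/-- The map `b ⊗ y ↦ σ(y) b`. -/
def rightExtension (A : Type u) [Ring A] [Algebra k A] [Module (Env k A) X]
    [IsScalarTower k (Env k A) X] (σ : Y →ₗ[k] X) : Aᵐᵒᵖ ⊗[k] Y →ₗ[k] X :=
  TensorProduct.lift (rightAct k A X).toLinearMap ∘ₗ σ.lTensor Aᵐᵒᵖ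

omit [Module A Y] [IsScalarTower k A Y] in
@[simp] theorem rightExtension_tmul (σ : Y →ₗ[k] X) (b : Aᵐᵒᵖ) (y : Y) :
    rightExtension A σ (b ⊗ₜ y) = rightAct k A X b (σ y) := rfl

omit [Module A Y] [IsScalarTower k A Y] in
theorem rightExtension_smul (σ : Y →ₗ[k] X) (b : Aᵐᵒᵖ) (z : Aᵐᵒᵖ ⊗[k] Y) :
    rightExtension A σ (b • z) = rightAct k A X b (rightExtension A σ z) := by
  induction z with
  | zero => simp
  | add z w hz hw => simp_all
  | tmul c y => simp [TensorProduct.smul_tmul']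

namespace IsRightReduction

variable (h : IsRightReduction G q)
include h

omit [IsScalarTower k A Y] in
-- In degree `d`, the difference `x - σ(q x)` lies in `X A_+`, so it comes from elements of lower
-- degree, already in the range.
theorem rightExtension_surjective (hg : IsBimoduleGrading G g) {σ : Y →ₗ[k] X}
    (hσ : ∀ y, q (σ y) = y) (hσg : ∀ i x, g.proj i (σ (q (g.proj i x))) = σ (q (g.proj i x))) :
    Function.Surjective (rightExtension A σ) := by
  have key (d : ℕ) : ∀ x, g.proj d x ∈ LinearMap.range (rightExtension A σ) := by
    induction d using Nat.strong_induction_on with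
    | _ d ih =>
      intro x
      have h1 : g.proj d x - σ (q (g.proj d x)) ∈ rightRadical G X := by
        rw [h.mem_rightRadical_iff, map_sub, hσ, sub_self]
      have h2 := hg.proj_mem_rightRadical d h1
      rw [map_sub, hσg, g.proj_proj, if_pos rfl] at h2
      have h3 : g.proj d x - σ (q (g.proj d x)) ∈ LinearMap.range (rightExtension A σ) := by
        refine Submodule.span_le.2 ?_ h2
        rintro _ ⟨i, j, b, y, hd, rfl⟩
        obtain ⟨z, hz⟩ := ih j (by omega) y
        exact ⟨G.op.proj (i + 1) b • z, by rw [rightExtension_smul, hz]⟩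
      have h4 : σ (q (g.proj d x)) ∈ LinearMap.range (rightExtension A σ) :=
        ⟨1 ⊗ₜ q (g.proj d x), by simp⟩
      simpa using add_mem h3 h4
  intro x
  rw [← LinearMap.mem_range]
  induction x using g.induction with
  | zero => simp
  | add x y hx hy => exact add_mem hx hy
  | proj i x => exact key i x

omit [IsScalarTower k A Y] in
-- Right projectivity of `X` makes the kernel `K` a right linear direct summand. Since `q ∘ σ` is
-- the identity, `K` lies in the span of multiples by `A_+`; applying the retraction gives `K = K
-- A_+`, and Nakayama gives `K = 0`. Degrees are those of the factor `Aᵐᵒᵖ`, so homogeneity of `σ`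
-- plays no role here.
theorem rightExtension_injective (hX : IsRightProjective k A X) {σ : Y →ₗ[k] X}
    (hσ : ∀ y, q (σ y) = y)
    (hsurj : Function.Surjective (rightExtension A σ)) :
    Function.Injective (rightExtension A σ) := by
  obtain ⟨φ, hφ⟩ : ∃ φ, φ = rightExtension A σ := ⟨_, rfl⟩
  have hφt (b : Aᵐᵒᵖ) (y : Y) : φ (b ⊗ₜ y) = rightAct k A X b (σ y) := by rw [hφ]; rfl
  have hφs (b : Aᵐᵒᵖ) (z : Aᵐᵒᵖ ⊗[k] Y) : φ (b • z) = rightAct k A X b (φ z) := by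
    rw [hφ, rightExtension_smul]
  rw [← hφ] at hsurj ⊢
  obtain ⟨s, hs, hsec⟩ := hX
  obtain ⟨ψ, hψ⟩ := φ.exists_rightInverse_of_surjective (LinearMap.range_eq_top.2 hsurj)
  replace hψ (x : X) : φ (ψ x) = x := LinearMap.congr_fun hψ x
  -- a right linear section of `φ`
  let θ : X →ₗ[k] Aᵐᵒᵖ ⊗[k] Y :=
    (actionMap k Aᵐᵒᵖ (Aᵐᵒᵖ ⊗[k] Y)).restrictScalars k ∘ₗ ψ.lTensor Aᵐᵒᵖ ∘ₗ s
  have hθ (x : X) : φ (θ x) = x := by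
    conv_rhs => rw [← hsec x]
    change φ (actionMap k Aᵐᵒᵖ (Aᵐᵒᵖ ⊗[k] Y) (ψ.lTensor Aᵐᵒᵖ (s x))) = _
    generalize s x = z
    induction z with
    | zero => simp
    | add z w hz hw => simp_all
    | tmul b x => simp [hφs, hψ]
  have hθr (b : Aᵐᵒᵖ) (x : X) : θ (rightAct k A X b x) = b • θ x := by
    change actionMap k Aᵐᵒᵖ (Aᵐᵒᵖ ⊗[k] Y) (ψ.lTensor Aᵐᵒᵖ (s (rightAct k A X b x))) =
      b • actionMap k Aᵐᵒᵖ (Aᵐᵒᵖ ⊗[k] Y) (ψ.lTensor Aᵐᵒᵖ (s x))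
    rw [hs, ← (actionMap k Aᵐᵒᵖ (Aᵐᵒᵖ ⊗[k] Y)).map_smul]
    refine congrArg _ ?_
    generalize s x = z
    induction z with
    | zero => simp
    | add z w hz hw => simp_all
    | tmul c x => simp [TensorProduct.smul_tmul']
  -- The right linear projection onto the kernel of `φ` along the image of `θ`.
  let r : Aᵐᵒᵖ ⊗[k] Y →ₗ[k] Aᵐᵒᵖ ⊗[k] Y := LinearMap.id - θ ∘ₗ φ
  have hr (z : Aᵐᵒᵖ ⊗[k] Y) : φ (r z) = 0 := by simp [r, hθ]
  have hr_smul (b : Aᵐᵒᵖ) (z : Aᵐᵒᵖ ⊗[k] Y) : r (b • z) = b • r z := by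
    simp [r, hφs, hθr, smul_sub]
  have hr_of {z : Aᵐᵒᵖ ⊗[k] Y} (hz : φ z = 0) : r z = z := by simp [r, hz]
  let W : Submodule k (Aᵐᵒᵖ ⊗[k] Y) :=
    Submodule.span k {w | ∃ i b z, w = G.op.proj (i + 1) b • z}
  have hW (z : Aᵐᵒᵖ ⊗[k] Y) : z - 1 ⊗ₜ q (φ z) ∈ W := by
    induction z with
    | zero => simp
    | add z w hz hw => simpa [TensorProduct.tmul_add, add_sub_add_comm] using add_mem hz hw
    | tmul b y =>
      induction b using G.op.induction with
      | zero => simp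
      | add b c hb hc =>
        rw [TensorProduct.add_tmul]
        simpa only [map_add, TensorProduct.tmul_add, add_sub_add_comm] using add_mem hb hc
      | proj i b =>
        cases i with
        | zero =>
          obtain ⟨c, hc⟩ := G.op.proj_zero b
          rw [hc, hφt, AlgHom.commutes, Module.algebraMap_end_apply, map_smul,
            hσ, Algebra.algebraMap_eq_smul_one, TensorProduct.smul_tmul, sub_self]
          exact zero_mem _
        | succ i =>
          rw [hφt, h.map_rightAct, TensorProduct.tmul_zero, sub_zero]
          exact Submodule.subset_span ⟨i, b, 1 ⊗ₜ y, by simp [TensorProduct.smul_tmul']⟩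
  have proj_smul (d i : ℕ) (b : Aᵐᵒᵖ) (z : Aᵐᵒᵖ ⊗[k] Y) :
      (G.op.proj d).rTensor Y (G.op.proj i b • z) =
        if i ≤ d then G.op.proj i b • (G.op.proj (d - i)).rTensor Y z else 0 := by
    induction z with
    | zero => simp
    | add z w hz hw => rw [smul_add, map_add, hz, hw, map_add, smul_add]; split_ifs <;> simp
    | tmul c y =>
      rw [TensorProduct.smul_tmul', smul_eq_mul, LinearMap.rTensor_tmul, G.op.proj_proj_mul]
      split_ifs <;> simp [TensorProduct.smul_tmul']
  have key (d : ℕ) : ∀ z, φ z = 0 → (G.op.proj d).rTensor Y z = 0 := by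
    induction d using Nat.strong_induction_on with
    | _ d ih =>
      intro z hz
      have hzW : z ∈ W := by simpa [hz] using hW z
      rw [← hr_of hz]
      refine (Submodule.span_le (p := LinearMap.ker ((G.op.proj d).rTensor Y ∘ₗ r))).2 ?_ hzW
      rintro _ ⟨i, b, w, rfl⟩
      rw [SetLike.mem_coe, LinearMap.mem_ker, LinearMap.comp_apply, hr_smul, proj_smul]
      split_ifs with hi
      · rw [ih (d - (i + 1)) (by omega) _ (hr w), smul_zero]
      · rfl
  rw [injective_iff_map_eq_zero]
  exact fun z hz => G.op.eq_zero_of_rTensor_proj fun d => key d z hz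

/-- Let `X` be a graded bimodule which is projective as a right module. If the left module
`X / X A_+` is projective then the bimodule `X` is projective. -/
theorem projective (hg : IsBimoduleGrading G g) (hX : IsRightProjective k A X)
    [Module.Projective A Y] : Module.Projective (Env k A) X := by
  obtain ⟨σ, hσl, hσ, hσg⟩ := h.exists_homogeneous_section hg
  have hsurj := h.rightExtension_surjective hg hσ hσg
  obtain ⟨t, ht⟩ := exists_section_actionMap k A Y
  let φ := LinearEquiv.ofBijective (rightExtension A σ)
    ⟨h.rightExtension_injective hX hσ hsurj, hsurj⟩
  let r : Env k A ⊗[k] Y →ₗ[Env k A] X :=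
    actionMap k (Env k A) X ∘ₗ TensorProduct.AlgebraTensorModule.map LinearMap.id σ
  -- The section `t` makes `Y` a summand of `A ⊗ Y`; tensoring with `Aᵐᵒᵖ` makes `X` a summand of
  -- the free module `Env k A ⊗ Y`.
  let j : Aᵐᵒᵖ ⊗[k] Y →ₗ[k] Env k A ⊗[k] Y :=
    (TensorProduct.assoc k A Aᵐᵒᵖ Y).symm.toLinearMap ∘ₗ
      (TensorProduct.leftComm k Aᵐᵒᵖ A Y).toLinearMap ∘ₗ (t.restrictScalars k).lTensor Aᵐᵒᵖ
  have hj (a : A) (b c : Aᵐᵒᵖ) (y : Y) :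
      j ((b * c) ⊗ₜ (a • y)) = (a ⊗ₜ[k] b : Env k A) • j (c ⊗ₜ y) := by
    simp only [j, LinearMap.comp_apply, LinearMap.lTensor_tmul, LinearMap.restrictScalars_apply,
      map_smul]
    generalize t y = z
    induction z with
    | zero => simp
    | add z w hz hw => simp_all [TensorProduct.tmul_add]
    | tmul d y => simp [TensorProduct.smul_tmul']
  have hφ (a : A) (b c : Aᵐᵒᵖ) (y : Y) :
      (a ⊗ₜ[k] b : Env k A) • φ (c ⊗ₜ y) = φ ((b * c) ⊗ₜ (a • y)) := by
    change (a ⊗ₜ[k] b : Env k A) • rightAct k A X c (σ y) = rightAct k A X (b * c) (σ (a • y))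
    rw [hσl, tmul_smul, map_mul, Module.End.mul_apply, rightAct_leftAct, rightAct_leftAct]
  let i : X →ₗ[Env k A] Env k A ⊗[k] Y :=
    bimoduleHom (X' := Env k A ⊗[k] Y) (j ∘ₗ φ.symm.toLinearMap)
      (fun a x => by
        obtain ⟨z, rfl⟩ := φ.surjective x
        induction z with
        | zero => simp
        | add z w hz hw => simp_all
        | tmul c y =>
          change j (φ.symm ((a ⊗ₜ[k] 1 : Env k A) • φ (c ⊗ₜ y))) =
            (a ⊗ₜ[k] 1 : Env k A) • j (φ.symm (φ (c ⊗ₜ y)))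
          rw [hφ, LinearEquiv.symm_apply_apply, LinearEquiv.symm_apply_apply, hj])
      (fun b x => by
        obtain ⟨z, rfl⟩ := φ.surjective x
        induction z with
        | zero => simp
        | add z w hz hw => simp_all
        | tmul c y =>
          change j (φ.symm ((1 ⊗ₜ[k] b : Env k A) • φ (c ⊗ₜ y))) =
            (1 ⊗ₜ[k] b : Env k A) • j (φ.symm (φ (c ⊗ₜ y)))
          rw [hφ, LinearEquiv.symm_apply_apply, LinearEquiv.symm_apply_apply, hj])
  refine Module.Projective.of_split i r (LinearMap.ext fun x => ?_)
  obtain ⟨z, rfl⟩ := φ.surjective x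
  change r (j (φ.symm (φ z))) = φ z
  rw [LinearEquiv.symm_apply_apply]
  induction z with
  | zero => simp
  | add z w hz hw => simp_all
  | tmul c y =>
    have : φ (c ⊗ₜ y) = rightAct k A X c (σ y) := rfl
    rw [this]
    conv_rhs => rw [← ht y]
    simp only [j, LinearMap.comp_apply, LinearMap.lTensor_tmul, LinearMap.restrictScalars_apply]
    generalize t y = z
    induction z with
    | zero => simp
    | add z w hz hw => simp_all [TensorProduct.tmul_add]
    | tmul d y => simp [r, tmul_smul, hσl, rightAct_leftAct]

end IsRightReduction

end GradedBimodule

/-- Syzygies commute with reduction and preserve both the grading and right projectivity. The base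
cases are graded Nakayama for `Y = 0` and `IsRightReduction.projective`. -/
theorem IsRightReduction.hasProjectiveDimensionLT {k : Type v} [Field k] {A : Type u} [Ring A]
    [Algebra k A] {G : ConnectedGrading k A} (n : ℕ) :
    ∀ {X Y : Type u} [AddCommGroup X] [Module k X] [Module (Env k A) X]
      [IsScalarTower k (Env k A) X] [AddCommGroup Y] [Module k Y] [Module A Y]
      [IsScalarTower k A Y] {q : X →ₗ[k] Y} {g : LinearGrading k X}, IsRightReduction G q →
      IsBimoduleGrading G g → IsRightProjective k A X →
      HasProjectiveDimensionLT (ModuleCat.of A Y) n →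
      HasProjectiveDimensionLT (ModuleCat.of (Env k A) X) n := by
  induction n with
  | zero =>
    intro X Y _ _ _ _ _ _ _ _ q g h hg _ hY
    rw [hasProjectiveDimensionLT_zero_iff] at hY ⊢
    exact h.subsingleton hg
  | succ n ih =>
    intro X Y _ _ _ _ _ _ _ _ q g h hg hr hY
    cases n with
    | zero =>
      rw [zero_add, hasProjectiveDimensionLT_one_iff] at hY ⊢
      exact h.projective hg hr
    | succ n =>
      have := hr.projective_leftInduced
      rw [hasProjectiveDimensionLT_ker_iff (actionMap k A Y) (actionMap_surjective k A Y)] at hY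
      rw [hasProjectiveDimensionLT_ker_iff (biActionMap k A X) (biActionMap_surjective k A X)]
      exact ih h.syzygy hg.biSyzygy hr.biSyzygy hY


/-! ### Hochschild dimension and global dimension of connected graded algebras -/

section Opposite

variable (k : Type v) [Field k] (A : Type u) [Ring A] [Algebra k A]

/-- The enveloping algebra of the opposite algebra. -/
def envOpEquiv : Env k Aᵐᵒᵖ ≃ₐ[k] Env k A :=
  (Algebra.TensorProduct.congr AlgEquiv.refl (AlgEquiv.opOp k A).symm).trans
    (Algebra.TensorProduct.comm k Aᵐᵒᵖ A)

theorem envOpEquiv_tmul (a : Aᵐᵒᵖ) (b : Aᵐᵒᵖᵐᵒᵖ) :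
    envOpEquiv k A (a ⊗ₜ b) = b.unop.unop ⊗ₜ a := rfl

attribute [local instance] TensorProduct.Algebra.module RingHomInvPair.of_ringEquiv

/-- Swapping the tensor factors identifies the two enveloping algebras and matches the regular
bimodules. -/
theorem hochschildDimension_op : hochschildDimension k Aᵐᵒᵖ = hochschildDimension k A := by
  let e : Env k Aᵐᵒᵖ ≃+* Env k A := (envOpEquiv k A).toRingEquiv
  let f : Aᵐᵒᵖ ≃ₛₗ[RingHomClass.toRingHom e] A :=
    { MulOpposite.opAddEquiv.symm with
      map_smul' := fun c x => by
        change (c • x).unop = envOpEquiv k A c • x.unop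
        induction c using TensorProduct.induction_on with
        | zero =>
          rw [map_zero]
          exact (congrArg MulOpposite.unop (zero_smul (Env k Aᵐᵒᵖ) x)).trans
            (zero_smul (Env k A) x.unop).symm
        | add c d hc hd =>
          rw [map_add]
          exact (congrArg MulOpposite.unop (add_smul c d x)).trans
            ((congrArg₂ (· + ·) hc hd).trans (add_smul _ _ x.unop).symm)
        | tmul a b =>
          rw [envOpEquiv_tmul, TensorProduct.Algebra.smul_def, TensorProduct.Algebra.smul_def]
          exact mul_assoc _ _ _ }
  exact ModuleCat.projectiveDimension_eq_of_semiLinearEquiv (M := ModuleCat.of (Env k Aᵐᵒᵖ) Aᵐᵒᵖ)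
    (N := ModuleCat.of (Env k A) A) e f

end Opposite

namespace ConnectedGrading

variable {k : Type v} [Field k] {A : Type u} [Ring A] [Algebra k A] (G : ConnectedGrading k A)

/-- The left ideal `A_+`. -/
def irrelevant : Submodule A A := Submodule.span A {a | ∃ i b, a = G.proj (i + 1) b}

attribute [local instance] TensorProduct.Algebra.module isScalarTower_env_self

theorem isBimoduleGrading_self : IsBimoduleGrading (X := A) G G.toLinearGrading where
  leftAct i j a x := by rw [leftAct_self, G.proj_mul]
  rightAct i j b x := by
    rw [rightAct_self, G.op_proj, MulOpposite.unop_op, add_comm, G.proj_mul]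

/-- The left ideal generated by `A_+` is also the span of products `x b` with `b` of positive
degree: left multiplications are right linear, hence preserve `rightRadical`. -/
theorem isRightReduction_mkQ :
    IsRightReduction (X := A) G (G.irrelevant.mkQ.restrictScalars k) where
  surjective := G.irrelevant.mkQ_surjective
  map_leftAct a x := by
    rw [leftAct_self]
    exact G.irrelevant.mkQ.map_smul a x
  map_rightAct i b x := by
    rw [rightAct_self, G.op_proj, MulOpposite.unop_op]
    exact (Submodule.Quotient.mk_eq_zero _).2
      (Submodule.smul_mem _ x (Submodule.subset_span ⟨i, _, rfl⟩))
  ker_le x hx := by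
    replace hx : x ∈ Submodule.span A {a | ∃ i b, a = G.proj (i + 1) b} :=
      (Submodule.Quotient.mk_eq_zero _).1 hx
    induction hx using Submodule.span_induction with
    | zero => exact zero_mem _
    | add x y _ _ hx hy => exact add_mem hx hy
    | smul a x _ hx =>
      rw [smul_eq_mul, ← leftAct_self (k := k)]
      exact rightRadical_le_comap G (leftAct k A A a)
        (fun b x => (rightAct_leftAct k A a b x).symm) hx
    | mem z hz =>
      obtain ⟨i, b, rfl⟩ := hz
      exact Submodule.subset_span ⟨i, .op b, 1, by simp [rightAct_self, G.op_proj]⟩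

include G in
/-- The Hochschild dimension of a connected graded algebra is its left global dimension. -/
theorem hochschildDimension_eq_leftGlobalDimension :
    hochschildDimension k A = leftGlobalDimension A := by
  refine le_antisymm (le_trans ?_ (le_iSup _ (ModuleCat.of A (A ⧸ G.irrelevant))))
    (leftGlobalDimension_le_hochschildDimension k A)
  exact projectiveDimension_le_of_forall fun n h =>
    G.isRightReduction_mkQ.hasProjectiveDimensionLT n G.isBimoduleGrading_self
      (isRightProjective_self k A) h

include G in
/-- The Hochschild dimension of a connected graded algebra is its right global dimension. -/
theorem hochschildDimension_eq_rightGlobalDimension :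
    hochschildDimension k A = rightGlobalDimension A :=
  (hochschildDimension_op k A).symm.trans G.op.hochschildDimension_eq_leftGlobalDimension

end ConnectedGrading

/-! ### The grading of a homogeneous algebra -/

namespace HomogeneousAlgebra

variable {k : Type u} [Field k] {V : Type v} [AddCommGroup V] [Module k V] {N : ℕ}
variable (R : Submodule k (⨂[k]^N V))

/-- The map `v ↦ v T` from `V` to polynomials over the homogeneous algebra. -/
noncomputable def generatorMonomial : V →ₗ[k] Polynomial (HomogeneousAlgebra R) :=
  (Polynomial.monomial 1).restrictScalars k ∘ₗ (proj R).toLinearMap ∘ₗ TensorAlgebra.ι k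

/-- A pure tensor becomes a word in generators, and each letter contributes one factor `T`. -/
theorem lift_generatorMonomial (n : ℕ) (t : ⨂[k]^n V) :
    TensorAlgebra.lift k (generatorMonomial R) (TensorPower.toTensorAlgebra t) =
      Polynomial.monomial n (proj R (TensorPower.toTensorAlgebra t)) := by
  induction t using PiTensorProduct.induction_on with
  | add x y hx hy => rw [map_add, map_add, hx, hy, map_add, map_add]
  | smul_tprod c x =>
    have key (l : List V) :
        TensorAlgebra.lift k (generatorMonomial R) (l.map (TensorAlgebra.ι k)).prod =
          Polynomial.monomial l.length (proj R (l.map (TensorAlgebra.ι k)).prod) := by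
      induction l with
      | nil => simp
      | cons v l ih =>
        simp only [List.map_cons, List.prod_cons, map_mul, ih, TensorAlgebra.lift_ι_apply,
          List.length_cons]
        simp [generatorMonomial, Polynomial.monomial_mul_monomial, add_comm]
    have h := key (List.ofFn x)
    rw [List.map_ofFn, List.length_ofFn] at h
    simp only [map_smul, TensorPower.toTensorAlgebra_tprod, TensorAlgebra.tprod_apply]
    rw [← Polynomial.smul_monomial]
    exact congrArg (c • ·) h

/-- The coaction `A → A[T]` which sends a homogeneous element `a` of degree `n` to `a T ^ n`. -/
noncomputable def coaction : HomogeneousAlgebra R →ₐ[k] Polynomial (HomogeneousAlgebra R) :=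
  RingQuot.liftAlgHom k ⟨TensorAlgebra.lift k (generatorMonomial R), by
    rintro x y ⟨⟨r, hr, rfl⟩, rfl⟩
    -- The relations are homogeneous of degree `N`, so they go to monomials with zero coefficient.
    have : proj R (TensorPower.toTensorAlgebra r) = 0 := by
      rw [← map_zero (proj R)]
      exact RingQuot.mkAlgHom_rel k ⟨⟨r, hr, rfl⟩, rfl⟩
    rw [lift_generatorMonomial, this, map_zero, map_zero]⟩

theorem coaction_proj (n : ℕ) (t : ⨂[k]^n V) :
    coaction R (proj R (TensorPower.toTensorAlgebra t)) =
      Polynomial.monomial n (proj R (TensorPower.toTensorAlgebra t)) := by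
  rw [← lift_generatorMonomial, coaction, proj, RingQuot.liftAlgHom_mkAlgHom_apply]

theorem span_homogeneous :
    Submodule.span k {a | ∃ (n : ℕ) (t : ⨂[k]^n V), a = proj R (TensorPower.toTensorAlgebra t)} =
      ⊤ := by
  rw [eq_top_iff]
  rintro a -
  obtain ⟨x, rfl⟩ := RingQuot.mkAlgHom_surjective k _ a
  rw [← TensorAlgebra.ofDirectSum_toDirectSum x]
  induction TensorAlgebra.toDirectSum x using DirectSum.induction_on with
  | zero => simp
  | add x y hx hy => rw [map_add, map_add]; exact add_mem hx hy
  | of n t =>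
    exact Submodule.subset_span ⟨n, t, congrArg (proj R) (DirectSum.toAddMonoid_of
      (fun n => (TensorPower.toTensorAlgebra (R := k) (M := V) (n := n)).toAddMonoidHom) n t)⟩

/-- The grading of a homogeneous algebra by the images of the tensor powers. -/
noncomputable def connectedGrading : ConnectedGrading k (HomogeneousAlgebra R) := by
  -- The component of degree `i` is the coefficient of `T ^ i` in the coaction.
  let p (i : ℕ) : HomogeneousAlgebra R →ₗ[k] HomogeneousAlgebra R :=
    (Polynomial.lcoeff (HomogeneousAlgebra R) i).restrictScalars k ∘ₗ (coaction R).toLinearMap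
  have hp (i n : ℕ) (t : ⨂[k]^n V) : p i (proj R (TensorPower.toTensorAlgebra t)) =
      if i = n then proj R (TensorPower.toTensorAlgebra t) else 0 := by
    change (coaction R _).coeff i = _
    rw [coaction_proj, Polynomial.coeff_monomial]
    simp only [eq_comm]
  -- Components are homogeneous for the coaction; as it is multiplicative, their products multiply
  -- like monomials, which yields `proj_mul`.
  have hθ (i : ℕ) (a : HomogeneousAlgebra R) :
      coaction R (p i a) = Polynomial.monomial i (p i a) := by
    have ha := (span_homogeneous R).ge (Submodule.mem_top (x := a))
    induction ha using Submodule.span_induction with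
    | zero => simp
    | add x y _ _ hx hy => rw [map_add, map_add, hx, hy, map_add]
    | smul c x _ hx => rw [map_smul, map_smul, hx, Polynomial.smul_monomial]
    | mem z hz =>
      obtain ⟨n, t, rfl⟩ := hz
      rw [hp]
      split_ifs with h
      · rw [coaction_proj, h]
      · simp
  refine
    { toLinearGrading := LinearGrading.ofSpan p _ (span_homogeneous R) ?_
      proj_mul := fun i j a b => ?_
      proj_zero := fun a => ?_ }
  · rintro _ ⟨n, t, rfl⟩
    exact ⟨n, fun i => hp i n t⟩
  · change (coaction R (p i a * p j b)).coeff (i + j) = p i a * p j b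
    rw [map_mul, hθ, hθ, Polynomial.monomial_mul_monomial, Polynomial.coeff_monomial, if_pos rfl]
  · change ∃ c, p 0 a = _
    have ha := (span_homogeneous R).ge (Submodule.mem_top (x := a))
    induction ha using Submodule.span_induction with
    | zero => exact ⟨0, by simp⟩
    | add x y _ _ hx hy =>
      obtain ⟨c, hc⟩ := hx
      obtain ⟨d, hd⟩ := hy
      exact ⟨c + d, by rw [map_add, hc, hd, map_add]⟩
    | smul c x _ hx =>
      obtain ⟨d, hd⟩ := hx
      exact ⟨c * d, by rw [map_smul, hd, map_mul, Algebra.smul_def]⟩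
    | mem z hz =>
      obtain ⟨n, t, rfl⟩ := hz
      rw [hp]
      split_ifs with h
      · subst h
        induction t using PiTensorProduct.induction_on with
        | add x y hx hy =>
          obtain ⟨c, hc⟩ := hx
          obtain ⟨d, hd⟩ := hy
          exact ⟨c + d, by rw [map_add, map_add, hc, hd, map_add]⟩
        | smul_tprod c x =>
          refine ⟨c, ?_⟩
          rw [map_smul, map_smul, TensorPower.toTensorAlgebra_tprod, TensorAlgebra.tprod_apply,
            Algebra.algebraMap_eq_smul_one]
          simp
      · exact ⟨0, by simp⟩

end HomogeneousAlgebra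

/-- The Koszul property is not used: the two dimensions agree for every connected graded algebra,
see `ConnectedGrading.hochschildDimension_eq_leftGlobalDimension`. -/
theorem theorem4p5 {k : Type u} [Field k] {V : Type v} [AddCommGroup V] [Module k V]
    [FiniteDimensional k V] (N : ℕ) (hN : 2 ≤ N) (R : Submodule k (⨂[k]^N V))
    (hR : IsKoszul R) :
    hochschildDimension k (HomogeneousAlgebra R) = leftGlobalDimension (HomogeneousAlgebra R) ∧
    hochschildDimension k (HomogeneousAlgebra R) = rightGlobalDimension (HomogeneousAlgebra R) :=
  ⟨(HomogeneousAlgebra.connectedGrading R).hochschildDimension_eq_leftGlobalDimension,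
    (HomogeneousAlgebra.connectedGrading R).hochschildDimension_eq_rightGlobalDimension⟩
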